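/- **Definitions.** A locally $C^*$-algebra is a complete Hausdorff complex topological $*$-algebra $A$ whose topology is determined by the set $S(A)$ of its continuous $C^*$-seminorms. A Hilbert $A$-module is a right $A$-module $E$, compatible with the complex structures, with a definite positive $A$-valued inner product, linear in the second variable, that is complete for the topology given by the seminorms $\bar p_E(\xi)=p(\langle\xi,\xi\rangle)^{1/2}$, $p\in S(A)$; it is full if the linear span of $\{\langle\xi,\eta\rangle:\xi,\eta\in E\}$ is dense in $A$. $L(E)$ is the $*$-algebra of adjointable operators on $E$, with the topology given by the seminorms $\tilde p(T)=\sup\{\bar p_E(T\xi):\bar p_E(\xi)\le 1\}$, $p\in S(A)$. $K(E)$ is the closed linear span in $L(E)$ of the operators $\theta_{\xi,\eta}(\zeta)=\xi\langle\eta,\zeta\rangle$. On $A\oplus E$ one has $(a\oplus\xi)b=ab\oplus\xi b$ and $\langle a\oplus\xi,b\oplus\eta\rangle=a^*b+\langle\xi,\eta\rangle$. For $a\in A$, $\xi,\eta\in E$, $T\in K(E)$ let $L_{a,\xi,\eta,T}\in L(A\oplus E)$ be $$L_{a,\xi,\eta,T}(b\oplus\zeta)=(ab+\langle\xi,\zeta\rangle)\oplus(\eta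 b+T\zeta).$$ The linking algebra $\mathcal L(E)$ is the closed $*$-subalgebra of $L(A\oplus E)$ generated by all $L_{a,\xi,\eta,T}$. An action of a group $G$ on a locally $C^*$-algebra is a homomorphism from $G$ to the group of its bicontinuous $*$-automorphisms. An action of $G$ on $E$ is a homomorphism from $G$ to the group $\mathrm{Aut}(E)$ of bijections $u:E\to E$ such that for each of $v=u$ and $v=u^{-1}$ there is a continuous $*$-homomorphism $\alpha:A\to A$ with $\langle v\xi,v\eta\rangle=\alpha(\langle\xi,\eta\rangle)$ for all $\xi,\eta\in E$. Such an action on $A$ or $E$ is continuous if it is jointly continuous, as a map $G\times A\to A$ or $G\times E\to E$. It is an inverse limit action if $A$ (respectively $E$) can be written as the inverse limit of a directed system of $C^*$-algebras (respectively of Hilbert $C^*$-modules, with $A$ the inverse limit of the underlying $C^*$-algebras) in such a way that each $g\in G$ acts as the inverse limit of the corresponding maps of actions of $G$ on the members of the system. **Proposition 3.1.** Let $G$ be a locally compact group, $A$ a locally $C^*$-algebra, $E$ a full Hilbert $A$-module, and $u$ an action of $G$ on $E$. Then $\mathcal L(E)=K(A\oplus E)$. There are a unique action $\alpha^u$ of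 $G$ on $A$ with $\alpha^u_g(\langle\xi,\eta\rangle)=\langle u_g\xi,u_g\eta\rangle$ and a unique action $\beta^u$ of $G$ on $K(E)$ with $\beta^u_g(\theta_{\xi,\eta})=\theta_{u_g\xi,u_g\eta}$ for all $g\in G$, $\xi,\eta\in E$. Moreover, there is a unique action $\gamma^u$ of $G$ on $\mathcal L(E)$ such that $$\gamma^u_g(L_{a,\xi,\eta,T})=L_{\alpha^u_g(a),\,u_g(\xi),\,u_g(\eta),\,\beta^u_g(T)}$$ for all $g\in G$, $a\in A$, $\xi,\eta\in E$, $T\in K(E)$. If $u$ is a continuous inverse limit action, then so is $\gamma^u$. -/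

import Mathlib

open Filter Topology

universe w₁ w₂ w₃ u v x

set_option linter.checkUnivs false

noncomputable section

namespace LCStar

/-! ### Locally C*-algebras -/

/-- A continuous C*-seminorm on a topological `*`-algebra; `CStarSeminorm A` is the set `S(A)`. -/
structure CStarSeminorm (A : Type*) [NonUnitalRing A] [StarRing A] [Module ℂ A]
    [TopologicalSpace A] extends Seminorm ℂ A where
  mul_le' : ∀ a b : A, toFun (a * b) ≤ toFun a * toFun b
  star_mul_self' : ∀ a : A, toFun (star a * a) = toFun a ^ 2
  continuous' : Continuous toFun

instance {A : Type*} [NonUnitalRing A] [StarRing A] [Module ℂ A] [TopologicalSpace A] :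
    CoeFun (CStarSeminorm A) (fun _ => A → ℝ) := ⟨fun p => p.toFun⟩

/-- A locally C*-algebra: a complete Hausdorff complex topological `*`-algebra in which
`a_i → 0` if and only if `p (a_i) → 0` for every continuous C*-seminorm `p`. (The uniform structure
is the one of the additive topological group; continuity of the operations follows.) -/
class IsLocallyCStarAlgebra (A : Type*) [NonUnitalRing A] [StarRing A] [Module ℂ A]
    [IsScalarTower ℂ A A] [SMulCommClass ℂ A A] [StarModule ℂ A] [UniformSpace A] : Prop where
  isUniformAddGroup : IsUniformAddGroup A
  complete : CompleteSpace A
  t2 : T2Space A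
  nhds_zero : 𝓝 (0 : A) = ⨅ p : CStarSeminorm A, comap p (𝓝 0)

/-- Positive elements: finite sums of elements `b* b` (the positive cone of Mathlib's
`StarOrderedRing`; in a locally C*-algebra each such sum is again of the form `b* b`). -/
def IsPositive {A : Type*} [NonUnitalRing A] [StarRing A] (a : A) : Prop :=
  a ∈ AddSubmonoid.closure (Set.range fun b : A => star b * b)

/-- The group of automorphisms of a locally C*-algebra: `*`-algebra automorphisms that are
continuous together with their inverse. -/
def AlgAut (A : Type*) [NonUnitalRing A] [StarRing A] [Module ℂ A] [TopologicalSpace A] :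
    Subgroup (A ≃⋆ₐ[ℂ] A) where
  carrier := {f | Continuous f ∧ Continuous f.symm}
  one_mem' := ⟨continuous_id, continuous_id⟩
  mul_mem' := fun hf hg => ⟨hf.1.comp hg.1, hg.2.comp hf.2⟩
  inv_mem' := fun hf => ⟨hf.2, hf.1⟩

/-! ### Hilbert modules -/

/-- A right `A`-module `E`, compatible with the complex structures, with an `A`-valued
inner product, linear in the second variable, satisfying all the axioms of a pre-Hilbert `A`-module
except definiteness (which is part of `HilbertModule`). -/
class InnerModule (A E : Type*) [NonUnitalRing A] [StarRing A] [Module ℂ A] [AddCommGroup E]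
    [Module ℂ E] extends Inner A E where
  /-- the right action `(ξ, a) ↦ ξ a` -/
  rsmul : E → A → E
  add_rsmul : ∀ (ξ η : E) (a : A), rsmul (ξ + η) a = rsmul ξ a + rsmul η a
  rsmul_add : ∀ (ξ : E) (a b : A), rsmul ξ (a + b) = rsmul ξ a + rsmul ξ b
  rsmul_mul : ∀ (ξ : E) (a b : A), rsmul ξ (a * b) = rsmul (rsmul ξ a) b
  smul_rsmul : ∀ (c : ℂ) (ξ : E) (a : A), rsmul (c • ξ) a = c • rsmul ξ a
  rsmul_smul : ∀ (c : ℂ) (ξ : E) (a : A), rsmul ξ (c • a) = c • rsmul ξ a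
  inner_add_right : ∀ ξ η ζ : E, inner ξ (η + ζ) = inner ξ η + inner ξ ζ
  inner_smul_right : ∀ (c : ℂ) (ξ η : E), inner ξ (c • η) = c • inner ξ η
  inner_rsmul_right : ∀ (ξ η : E) (a : A), inner ξ (rsmul η a) = inner ξ η * a
  star_inner : ∀ ξ η : E, star (inner ξ η) = inner η ξ
  inner_self_pos : ∀ ξ : E, IsPositive (inner ξ ξ)

open InnerModule (rsmul)

section Basic

variable {A E : Type*} [NonUnitalRing A] [StarRing A] [Module ℂ A] [AddCommGroup E] [Module ℂ E]
  [InnerModule A E]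

/-- The seminorm `p̄_E (ξ) = √(p ⟨ξ, ξ⟩)`. -/
def moduleSeminorm [TopologicalSpace A] (p : CStarSeminorm A) (ξ : E) : ℝ :=
  Real.sqrt (p (inner A ξ ξ))

theorem inner_add_left (ξ η ζ : E) : inner A (ξ + η) ζ = inner A ξ ζ + inner A η ζ := by
  rw [← InnerModule.star_inner, InnerModule.inner_add_right, star_add, InnerModule.star_inner,
    InnerModule.star_inner]

theorem inner_smul_left [StarModule ℂ A] (c : ℂ) (ξ η : E) :
    inner A (c • ξ) η = star c • inner A ξ η := by
  rw [← InnerModule.star_inner, InnerModule.inner_smul_right, star_smul, InnerModule.star_inner]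

theorem inner_rsmul_left (ξ η : E) (a : A) :
    inner A (rsmul ξ a) η = star a * inner A ξ η := by
  rw [← InnerModule.star_inner, InnerModule.inner_rsmul_right, star_mul, InnerModule.star_inner]

theorem inner_zero_right (ξ : E) : inner A ξ (0 : E) = 0 := by
  have h := InnerModule.inner_smul_right (A := A) 0 ξ (0 : E)
  simpa using h

theorem inner_zero_left (ξ : E) : inner A (0 : E) ξ = 0 := by
  rw [← InnerModule.star_inner, inner_zero_right, star_zero]

end Basic

/-- `E` is a Hilbert `A`-module: the inner product is definite, the topology of `E` is the one
determined by the seminorms `p̄_E`, `p ∈ S(A)`, and `E` is complete. When `A` is a C*-algebra these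
are the usual Hilbert C*-modules. -/
class HilbertModule (A E : Type*) [NonUnitalRing A] [StarRing A] [Module ℂ A]
    [TopologicalSpace A] [AddCommGroup E] [Module ℂ E] [UniformSpace E] [InnerModule A E] :
    Prop where
  inner_self_eq_zero : ∀ ξ : E, inner A ξ ξ = 0 ↔ ξ = 0
  isUniformAddGroup : IsUniformAddGroup E
  nhds_zero : 𝓝 (0 : E) = ⨅ p : CStarSeminorm A, comap (fun ξ : E => moduleSeminorm p ξ) (𝓝 0)
  complete : CompleteSpace E

/-- `E` is full: the linear span of the inner products is dense in `A`. -/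
def IsFull (A E : Type*) [NonUnitalRing A] [StarRing A] [Module ℂ A] [TopologicalSpace A]
    [AddCommGroup E] [Module ℂ E] [InnerModule A E] : Prop :=
  Dense (Submodule.span ℂ {a : A | ∃ ξ η : E, a = inner A ξ η} : Set A)

/-- A morphism of Hilbert modules from `E` (over `A`) to `F` (over `B`). -/
def IsHilbertMorphism (A B : Type*) {E F : Type*}
    [NonUnitalRing A] [StarRing A] [Module ℂ A] [TopologicalSpace A]
    [NonUnitalRing B] [StarRing B] [Module ℂ B] [TopologicalSpace B]
    [AddCommGroup E] [Module ℂ E] [InnerModule A E] [AddCommGroup F] [Module ℂ F]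
    [InnerModule B F] (u : E → F) : Prop :=
  ∃ α : A →⋆ₙₐ[ℂ] B, Continuous α ∧ ∀ ξ η : E, inner B (u ξ) (u η) = α (inner A ξ η)

/-- The group `Aut(E)` of automorphisms of the Hilbert `A`-module `E`. -/
def HilbertAut (A E : Type*) [NonUnitalRing A] [StarRing A] [Module ℂ A] [TopologicalSpace A]
    [AddCommGroup E] [Module ℂ E] [InnerModule A E] : Subgroup (Equiv.Perm E) where
  carrier := {u | IsHilbertMorphism A A u ∧ IsHilbertMorphism A A u.symm}
  one_mem' := ⟨⟨NonUnitalStarAlgHom.id ℂ A, continuous_id, fun _ _ => rfl⟩,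
    ⟨NonUnitalStarAlgHom.id ℂ A, continuous_id, fun _ _ => rfl⟩⟩
  mul_mem' := by
    rintro u v ⟨⟨α, hα, hu⟩, ⟨α', hα', hu'⟩⟩ ⟨⟨β, hβ, hv⟩, ⟨β', hβ', hv'⟩⟩
    refine ⟨⟨α.comp β, hα.comp hβ, fun ξ η => ?_⟩, ⟨β'.comp α', hβ'.comp hα', fun ξ η => ?_⟩⟩
    · exact (hu _ _).trans (congrArg α (hv ξ η))
    · exact (hv' _ _).trans (congrArg β' (hu' ξ η))
  inv_mem' := fun hu => ⟨hu.2, hu.1⟩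

/-! ### Adjointable operators -/

/-- `L(E)`: adjointable operators, i.e. maps `T` together with a map `T*` such that
`⟨T ξ, η⟩ = ⟨ξ, T* η⟩`. On a Hilbert module `T*` is determined by `T`, and `T` is automatically
`A`-linear and continuous. -/
@[ext]
structure AdjointableOp (A E : Type*) [NonUnitalRing A] [StarRing A] [Module ℂ A]
    [AddCommGroup E] [Module ℂ E] [InnerModule A E] where
  /-- the operator -/
  op : E →ₗ[ℂ] E
  /-- its adjoint -/
  adj : E →ₗ[ℂ] E
  inner_op : ∀ ξ η : E, inner A (op ξ) η = inner A ξ (adj η)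

namespace AdjointableOp

set_option linter.unusedSectionVars false

variable {A E : Type*} [NonUnitalRing A] [StarRing A] [Module ℂ A] [StarModule ℂ A]
  [AddCommGroup E] [Module ℂ E] [InnerModule A E]

instance : Zero (AdjointableOp A E) :=
  ⟨⟨0, 0, fun ξ η => by simp [inner_zero_left, inner_zero_right]⟩⟩

instance : One (AdjointableOp A E) := ⟨⟨1, 1, fun _ _ => rfl⟩⟩

instance : Add (AdjointableOp A E) :=
  ⟨fun S T => ⟨S.op + T.op, S.adj + T.adj, fun ξ η => by
    simp [inner_add_left, InnerModule.inner_add_right, S.inner_op, T.inner_op]⟩⟩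

instance : SMul ℂ (AdjointableOp A E) :=
  ⟨fun c T => ⟨c • T.op, star c • T.adj, fun ξ η => by
    simp [inner_smul_left, InnerModule.inner_smul_right, T.inner_op]⟩⟩

instance : Neg (AdjointableOp A E) := ⟨fun T => ⟨-T.op, -T.adj, fun ξ η => by
  have h := ((-1 : ℂ) • T).inner_op ξ η
  change inner A ((-1 : ℂ) • T.op ξ) η = inner A ξ (star (-1 : ℂ) • T.adj η) at h
  simpa using h⟩⟩

instance : Mul (AdjointableOp A E) :=
  ⟨fun S T => ⟨S.op * T.op, T.adj * S.adj, fun ξ η => by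
    simp [S.inner_op, T.inner_op]⟩⟩

instance : Star (AdjointableOp A E) :=
  ⟨fun T => ⟨T.adj, T.op, fun ξ η => by
    rw [← InnerModule.star_inner, ← T.inner_op, InnerModule.star_inner]⟩⟩

@[simp] theorem zero_op : (0 : AdjointableOp A E).op = 0 := rfl
@[simp] theorem zero_adj : (0 : AdjointableOp A E).adj = 0 := rfl
@[simp] theorem one_op : (1 : AdjointableOp A E).op = 1 := rfl
@[simp] theorem one_adj : (1 : AdjointableOp A E).adj = 1 := rfl
@[simp] theorem add_op (S T : AdjointableOp A E) : (S + T).op = S.op + T.op := rfl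
@[simp] theorem add_adj (S T : AdjointableOp A E) : (S + T).adj = S.adj + T.adj := rfl
@[simp] theorem neg_op (T : AdjointableOp A E) : (-T).op = -T.op := rfl
@[simp] theorem neg_adj (T : AdjointableOp A E) : (-T).adj = -T.adj := rfl
@[simp] theorem smul_op (c : ℂ) (T : AdjointableOp A E) : (c • T).op = c • T.op := rfl
@[simp] theorem smul_adj (c : ℂ) (T : AdjointableOp A E) : (c • T).adj = star c • T.adj := rfl
@[simp] theorem mul_op (S T : AdjointableOp A E) : (S * T).op = S.op * T.op := rfl
@[simp] theorem mul_adj (S T : AdjointableOp A E) : (S * T).adj = T.adj * S.adj := rfl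
@[simp] theorem star_op (T : AdjointableOp A E) : (star T).op = T.adj := rfl
@[simp] theorem star_adj (T : AdjointableOp A E) : (star T).adj = T.op := rfl

instance : Ring (AdjointableOp A E) where
  add_assoc _ _ _ := by ext1 <;> simp [add_assoc]
  zero_add _ := by ext1 <;> simp
  add_zero _ := by ext1 <;> simp
  add_comm _ _ := by ext1 <;> simp [add_comm]
  neg_add_cancel _ := by ext1 <;> simp
  nsmul := nsmulRec
  zsmul := zsmulRec
  mul_assoc _ _ _ := by ext1 <;> simp [mul_assoc]
  one_mul _ := by ext1 <;> simp
  mul_one _ := by ext1 <;> simp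
  zero_mul _ := by ext1 <;> simp
  mul_zero _ := by ext1 <;> simp
  left_distrib _ _ _ := by ext1 <;> simp [mul_add, add_mul]
  right_distrib _ _ _ := by ext1 <;> simp [mul_add, add_mul]

instance : Module ℂ (AdjointableOp A E) where
  one_smul _ := by ext1 <;> simp
  mul_smul c d _ := by ext1 <;> simp [mul_smul]
  smul_zero _ := by ext1 <;> simp
  smul_add _ _ _ := by ext1 <;> simp
  add_smul _ _ _ := by ext1 <;> simp [add_smul]
  zero_smul _ := by ext1 <;> simp

instance : IsScalarTower ℂ (AdjointableOp A E) (AdjointableOp A E) :=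
  ⟨fun _ _ _ => by ext1 <;> simp [smul_eq_mul]⟩

instance : SMulCommClass ℂ (AdjointableOp A E) (AdjointableOp A E) :=
  ⟨fun _ _ _ => by ext1 <;> simp [smul_eq_mul]⟩

instance : StarRing (AdjointableOp A E) where
  star_involutive _ := rfl
  star_mul _ _ := rfl
  star_add _ _ := rfl

instance : StarModule ℂ (AdjointableOp A E) :=
  ⟨fun _ _ => by ext1 <;> simp⟩

/-- The seminorm `p̃ (T) = ‖(π_p)_* T‖`, the operator norm of the operator induced by `T` on `E_p`,
i.e. the supremum of `p̄_E (T ξ)` over all `ξ` with `p̄_E (ξ) ≤ 1`. It is taken in `[0, ∞]`, although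
it is finite when `E` is a Hilbert module. -/
def opSeminorm [TopologicalSpace A] (p : CStarSeminorm A) (T : AdjointableOp A E) : ENNReal :=
  ⨆ (ξ : E) (_ : moduleSeminorm p ξ ≤ 1), ENNReal.ofReal (moduleSeminorm p (T.op ξ))

/-- The topology of `L(E)` determined by the seminorms `p̃`, `p ∈ S(A)`: the coarsest one that
makes all `T ↦ p̃ (T - S)` continuous. -/
instance [TopologicalSpace A] : TopologicalSpace (AdjointableOp A E) :=
  ⨅ (p : CStarSeminorm A) (S : AdjointableOp A E),
    TopologicalSpace.induced (fun T => opSeminorm p (T - S)) inferInstance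

/-- The rank one operator `θ_{η,ξ} (ζ) = η ⟨ξ, ζ⟩`. -/
def rankOne (η ξ : E) : AdjointableOp A E where
  op :=
    { toFun := fun ζ => rsmul η (inner A ξ ζ)
      map_add' := fun x y => by rw [InnerModule.inner_add_right, InnerModule.rsmul_add]
      map_smul' := fun c x => by
        rw [InnerModule.inner_smul_right, InnerModule.rsmul_smul, RingHom.id_apply] }
  adj :=
    { toFun := fun ζ => rsmul ξ (inner A η ζ)
      map_add' := fun x y => by rw [InnerModule.inner_add_right, InnerModule.rsmul_add]
      map_smul' := fun c x => by
        rw [InnerModule.inner_smul_right, InnerModule.rsmul_smul, RingHom.id_apply] }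
  inner_op x y := by
    change inner A (rsmul η (inner A ξ x)) y = inner A x (rsmul ξ (inner A η y))
    rw [inner_rsmul_left, InnerModule.inner_rsmul_right, InnerModule.star_inner]

end AdjointableOp

/-- The closed `*`-subalgebra generated by a set. -/
def closedStarAlgebraGenerated {B : Type*} [NonUnitalRing B] [StarRing B] [Module ℂ B]
    [IsScalarTower ℂ B B] [SMulCommClass ℂ B B] [StarModule ℂ B] [TopologicalSpace B]
    (s : Set B) : NonUnitalStarSubalgebra ℂ B :=
  sInf {S | IsClosed (S : Set B) ∧ s ⊆ S}

theorem subset_closedStarAlgebraGenerated {B : Type*} [NonUnitalRing B] [StarRing B]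
    [Module ℂ B] [IsScalarTower ℂ B B] [SMulCommClass ℂ B B] [StarModule ℂ B]
    [TopologicalSpace B] (s : Set B) : s ⊆ closedStarAlgebraGenerated s := by
  intro x hx
  exact NonUnitalStarAlgebra.mem_sInf.2 fun S hS => hS.2 hx

section Compacts

variable (A E : Type*) [NonUnitalRing A] [StarRing A] [Module ℂ A] [StarModule ℂ A]
  [TopologicalSpace A] [AddCommGroup E] [Module ℂ E] [InnerModule A E]

/-- `K(E)`: the closed `*`-subalgebra of `L(E)` generated by the rank one operators. Since the
linear span of these is a `*`-ideal, it is also the closure of their linear span. -/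
def compacts : NonUnitalStarSubalgebra ℂ (AdjointableOp A E) :=
  closedStarAlgebraGenerated {T | ∃ ξ η : E, T = AdjointableOp.rankOne ξ η}

variable {A E}

/-- The rank one operator `θ_{η,ξ}` as an element of `K(E)`. -/
def theta (η ξ : E) : compacts A E :=
  ⟨AdjointableOp.rankOne η ξ, subset_closedStarAlgebraGenerated _ ⟨η, ξ, rfl⟩⟩

end Compacts

/-! ### The linking algebra -/

section Linking

variable {A E : Type*} [NonUnitalRing A] [StarRing A] [Module ℂ A] [IsScalarTower ℂ A A]
  [SMulCommClass ℂ A A] [StarModule ℂ A] [AddCommGroup E] [Module ℂ E] [InnerModule A E]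

/-- The direct sum `A ⊕ E`: `(a ⊕ ξ) b = ab ⊕ ξb` and `⟨a ⊕ ξ, b ⊕ η⟩ = a* b + ⟨ξ, η⟩`. -/
instance directSumInnerModule : InnerModule A (A × E) where
  inner x y := star x.1 * y.1 + inner A x.2 y.2
  rsmul x b := (x.1 * b, rsmul x.2 b)
  add_rsmul x y a := by ext <;> simp [add_mul, InnerModule.add_rsmul]
  rsmul_add x a b := by ext <;> simp [mul_add, InnerModule.rsmul_add]
  rsmul_mul x a b := by ext <;> simp [mul_assoc, InnerModule.rsmul_mul]
  smul_rsmul c x a := by ext <;> simp [InnerModule.smul_rsmul, smul_mul_assoc]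
  rsmul_smul c x a := by ext <;> simp [InnerModule.rsmul_smul, mul_smul_comm]
  inner_add_right x y z := by
    simp only [Prod.fst_add, Prod.snd_add, mul_add, InnerModule.inner_add_right]; abel
  inner_smul_right c x y := by simp [InnerModule.inner_smul_right, mul_smul_comm]
  inner_rsmul_right x y a := by simp [InnerModule.inner_rsmul_right, add_mul, mul_assoc]
  star_inner x y := by simp [InnerModule.star_inner]
  inner_self_pos x :=
    add_mem (AddSubmonoid.subset_closure ⟨x.1, rfl⟩) (InnerModule.inner_self_pos x.2)

/-- `L_{a,ξ,η,T} (b ⊕ ζ) = (a b + ⟨ξ, ζ⟩) ⊕ (η b + T ζ)`, with adjoint `L_{a*,η,ξ,T*}`. -/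
def linkingOp (a : A) (ξ η : E) (T : AdjointableOp A E) : AdjointableOp A (A × E) where
  op :=
    { toFun := fun x => (a * x.1 + inner A ξ x.2, rsmul η x.1 + T.op x.2)
      map_add' := fun x y => by
        ext
        · simp only [Prod.fst_add, Prod.snd_add, mul_add, InnerModule.inner_add_right]; abel
        · simp only [Prod.fst_add, Prod.snd_add, InnerModule.rsmul_add, map_add]; abel
      map_smul' := fun c x => by
        ext <;> simp [InnerModule.inner_smul_right, InnerModule.rsmul_smul, mul_smul_comm] }
  adj :=
    { toFun := fun x => (star a * x.1 + inner A η x.2, rsmul ξ x.1 + T.adj x.2)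
      map_add' := fun x y => by
        ext
        · simp only [Prod.fst_add, Prod.snd_add, mul_add, InnerModule.inner_add_right]; abel
        · simp only [Prod.fst_add, Prod.snd_add, InnerModule.rsmul_add, map_add]; abel
      map_smul' := fun c x => by
        ext <;> simp [InnerModule.inner_smul_right, InnerModule.rsmul_smul, mul_smul_comm] }
  inner_op x y := by
    change star (a * x.1 + inner A ξ x.2) * y.1 + inner A (rsmul η x.1 + T.op x.2) y.2
      = star x.1 * (star a * y.1 + inner A η y.2) + inner A x.2 (rsmul ξ y.1 + T.adj y.2)
    rw [star_add, star_mul, InnerModule.star_inner, inner_add_left, inner_rsmul_left, T.inner_op,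
      InnerModule.inner_add_right, InnerModule.inner_rsmul_right, add_mul, mul_add, mul_assoc]
    abel

variable [TopologicalSpace A]

variable (A E) in
/-- The linking algebra of `E`: the closed `*`-subalgebra of `L(A ⊕ E)` generated by the operators
`L_{a,ξ,η,T}` with `a ∈ A`, `ξ, η ∈ E` and `T ∈ K(E)`. -/
def linkingAlgebra : NonUnitalStarSubalgebra ℂ (AdjointableOp A (A × E)) :=
  closedStarAlgebraGenerated
    {L | ∃ (a : A) (ξ η : E) (T : compacts A E), L = linkingOp a ξ η T.1}

/-- The operator `L_{a,ξ,η,T}` as an element of the linking algebra. -/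
def linkingElt (a : A) (ξ η : E) (T : compacts A E) : linkingAlgebra A E :=
  ⟨linkingOp a ξ η T.1, subset_closedStarAlgebraGenerated _ ⟨a, ξ, η, T, rfl⟩⟩

end Linking

/-! ### Inverse limits -/

/-- An inverse system of C*-algebras. -/
structure CStarSystem (Λ : Type w₁) [Preorder Λ] where
  alg : Λ → Type w₂
  [cstar : ∀ l, NonUnitalCStarAlgebra (alg l)]
  /-- the connecting morphisms `π_{lm}`, `l ≥ m` -/
  map : ∀ {l m : Λ}, m ≤ l → alg l →⋆ₙₐ[ℂ] alg m
  map_self : ∀ (l : Λ) (a : alg l), map (le_refl l) a = a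
  map_map : ∀ {l m n : Λ} (h : m ≤ l) (h' : n ≤ m) (a : alg l),
    map h' (map h a) = map (h'.trans h) a

attribute [instance] CStarSystem.cstar

/-- `A`, with the canonical maps `π l`, is the inverse limit of the system `S` of C*-algebras:
`a ↦ (π l a)_l` is a homeomorphic `*`-isomorphism onto the algebra of coherent families, with the
topology of coordinatewise convergence. -/
structure CStarSystem.IsLimit {Λ : Type w₁} [Preorder Λ] (S : CStarSystem.{w₁, w₂} Λ)
    {A : Type u} [NonUnitalRing A] [StarRing A] [Module ℂ A] [TopologicalSpace A]
    (π : ∀ l, A →⋆ₙₐ[ℂ] S.alg l) : Prop where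
  coherent : ∀ {l m : Λ} (h : m ≤ l) (a : A), S.map h (π l a) = π m a
  existsUnique : ∀ b : ∀ l, S.alg l, (∀ {l m : Λ} (h : m ≤ l), S.map h (b l) = b m) →
    ∃! a : A, ∀ l, π l a = b l
  topology_eq : ‹TopologicalSpace A› = ⨅ l, TopologicalSpace.induced (π l) inferInstance

/-- An inverse system of Hilbert C*-modules. -/
structure HilbertSystem (Λ : Type w₁) [Preorder Λ] extends CStarSystem.{w₁, w₂} Λ where
  mod : Λ → Type w₃
  [addCommGroup : ∀ l, AddCommGroup (mod l)]
  [module : ∀ l, Module ℂ (mod l)]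
  [uniformSpace : ∀ l, UniformSpace (mod l)]
  [innerModule : ∀ l, InnerModule (alg l) (mod l)]
  [hilbertModule : ∀ l, HilbertModule (alg l) (mod l)]
  /-- the connecting maps `σ_{lm}`, `l ≥ m` -/
  mmap : ∀ {l m : Λ}, m ≤ l → mod l →ₗ[ℂ] mod m
  mmap_rsmul : ∀ {l m : Λ} (h : m ≤ l) (ξ : mod l) (a : alg l),
    mmap h (rsmul ξ a) = rsmul (mmap h ξ) (map h a)
  inner_mmap : ∀ {l m : Λ} (h : m ≤ l) (ξ η : mod l),
    inner (alg m) (mmap h ξ) (mmap h η) = map h (inner (alg l) ξ η)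
  mmap_self : ∀ (l : Λ) (ξ : mod l), mmap (le_refl l) ξ = ξ
  mmap_mmap : ∀ {l m n : Λ} (h : m ≤ l) (h' : n ≤ m) (ξ : mod l),
    mmap h' (mmap h ξ) = mmap (h'.trans h) ξ

attribute [instance] HilbertSystem.addCommGroup HilbertSystem.module HilbertSystem.uniformSpace
  HilbertSystem.innerModule HilbertSystem.hilbertModule

/-- The Hilbert `A`-module `E`, with the canonical maps `π l : A → A_l` and `σ l : E → E_l`, is the
inverse limit of the system `S` of Hilbert C*-modules. (The topology of `E`, being determined by
that of `A`, is then the topology of coordinatewise convergence.) -/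
structure HilbertSystem.IsLimit {Λ : Type w₁} [Preorder Λ] (S : HilbertSystem.{w₁, w₂, w₃} Λ)
    {A : Type u} {E : Type v} [NonUnitalRing A] [StarRing A] [Module ℂ A] [TopologicalSpace A]
    [AddCommGroup E] [Module ℂ E] [InnerModule A E]
    (π : ∀ l, A →⋆ₙₐ[ℂ] S.alg l) (σ : ∀ l, E →ₗ[ℂ] S.mod l) : Prop where
  alg_isLimit : S.toCStarSystem.IsLimit π
  map_rsmul : ∀ (l : Λ) (ξ : E) (a : A), σ l (rsmul ξ a) = rsmul (σ l ξ) (π l a)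
  map_inner : ∀ (l : Λ) (ξ η : E), inner (S.alg l) (σ l ξ) (σ l η) = π l (inner A ξ η)
  coherent : ∀ {l m : Λ} (h : m ≤ l) (ξ : E), S.mmap h (σ l ξ) = σ m ξ
  existsUnique : ∀ z : ∀ l, S.mod l, (∀ {l m : Λ} (h : m ≤ l), S.mmap h (z l) = z m) →
    ∃! ξ : E, ∀ l, σ l ξ = z l

/-! ### Actions

An action of `G` on a locally C*-algebra `A` is a homomorphism `G →* AlgAut A`, an action of `G`
on a Hilbert `A`-module `E` is a homomorphism `G →* HilbertAut A E`. -/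

section Actions

variable {G : Type x} [Group G] {A : Type u} [NonUnitalRing A] [StarRing A] [Module ℂ A]
  [TopologicalSpace A]

/-- Joint continuity of `(g, a) ↦ α_g (a)`. -/
def IsContinuousAlgAction [TopologicalSpace G] (α : G →* AlgAut A) : Prop :=
  Continuous fun z : G × A => (α z.1).1 z.2

/-- `A` can be written as an inverse limit of C*-algebras `A_l` such that `α_g = lim α_g^l` for
actions `α^l` of `G` on `A_l`. -/
def IsInverseLimitAlgAction (α : G →* AlgAut A) : Prop :=
  ∃ (Λ : Type w₁) (_ : Preorder Λ) (_ : IsDirectedOrder Λ) (_ : Nonempty Λ)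
    (S : CStarSystem.{w₁, w₂} Λ) (π : ∀ l, A →⋆ₙₐ[ℂ] S.alg l)
    (αl : ∀ l, G →* AlgAut (S.alg l)),
    S.IsLimit π ∧
    (∀ {l m : Λ} (h : m ≤ l) (g : G) (a : S.alg l),
      S.map h ((αl l g).1 a) = (αl m g).1 (S.map h a)) ∧
    ∀ (l : Λ) (g : G) (a : A), π l ((α g).1 a) = (αl l g).1 (π l a)

variable {E : Type v} [AddCommGroup E] [Module ℂ E] [InnerModule A E]

/-- Joint continuity of `(g, ξ) ↦ u_g (ξ)`. -/
def IsContinuousAction [TopologicalSpace G] [TopologicalSpace E] (u : G →* HilbertAut A E) :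
    Prop :=
  Continuous fun z : G × E => (u z.1).1 z.2

/-- `E` can be written as an inverse limit of Hilbert C*-modules `E_l` such that `u_g = lim u_g^l`
for actions `u^l` of `G` on `E_l`. -/
def IsInverseLimitAction (u : G →* HilbertAut A E) : Prop :=
  ∃ (Λ : Type w₁) (_ : Preorder Λ) (_ : IsDirectedOrder Λ) (_ : Nonempty Λ)
    (S : HilbertSystem.{w₁, w₂, w₃} Λ) (π : ∀ l, A →⋆ₙₐ[ℂ] S.alg l)
    (σ : ∀ l, E →ₗ[ℂ] S.mod l) (ul : ∀ l, G →* HilbertAut (S.alg l) (S.mod l)),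
    S.IsLimit π σ ∧
    (∀ {l m : Λ} (h : m ≤ l) (g : G) (ξ : S.mod l),
      S.mmap h ((ul l g).1 ξ) = (ul m g).1 (S.mmap h ξ)) ∧
    ∀ (l : Λ) (g : G) (ξ : E), σ l ((u g).1 ξ) = (ul l g).1 (σ l ξ)

/-- `α` is the action on `A` induced by `u`: `α_g ⟨ξ, η⟩ = ⟨u_g ξ, u_g η⟩`. -/
def IsInducedOnAlgebra (u : G →* HilbertAut A E) (α : G →* AlgAut A) : Prop :=
  ∀ (g : G) (ξ η : E), (α g).1 (inner A ξ η) = inner A ((u g).1 ξ) ((u g).1 η)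

/-- `β` is the action on `K(E)` induced by `u`: `β_g (θ_{ξ,η}) = θ_{u_g ξ, u_g η}`. -/
def IsInducedOnCompacts [StarModule ℂ A] (u : G →* HilbertAut A E)
    (β : G →* AlgAut (compacts A E)) : Prop :=
  ∀ (g : G) (ξ η : E), (β g).1 (theta ξ η) = theta ((u g).1 ξ) ((u g).1 η)

end Actions

end LCStar

end

open LCStar

/-!
The action `γ` is conjugation by the automorphisms `α_g ⊕ u_g` of the Hilbert module `A ⊕ E`, acting
on `K(A ⊕ E)`. Three points have to be settled.

*The algebra.* `𝓛(E) = K(A ⊕ E)` (`linkingAlgebra_eq_compacts`). On the one hand,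
`θ_{a ⊕ ξ, b ⊕ η} = L_{a b*, η a*, ξ b*, θ_{ξ,η}}`. On the other hand, `L_{a,ξ,η,T}` is the sum of
the column `L_{a,0,η,0}`, the adjoint of the column `L_{0,0,ξ,0}`, and the corner `L_{0,0,0,T}`.
A column `c ⊕ ζ ↦ x c` is a limit of rank one operators because `x - x e` is small for suitable
`e ∈ A`, and `T ↦ L_{0,0,0,T}` is a continuous `*`-homomorphism mapping rank one operators to rank
one operators.

*Existence and uniqueness.* An automorphism of `E` is linear and intertwines the module structure
because `⟨uξ, uη⟩ = α⟨ξ, η⟩` determines `uη`; so `T ↦ u T u⁻¹` is a `*`-automorphism of `L(E)` which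
maps `θ_{ξ,η}` to `θ_{uξ,uη}` and hence preserves `K(E)`. If `E` is full, `α` is unique, so the `α`
attached to the automorphisms `u_g` form an action. Automorphisms of a closed `*`-algebra are
determined on generators.

*Continuity.* In an inverse limit action the seminorms `q(a) = ‖π_l a‖` are cofinal in `S(A)`, and
they are `α`-invariant since `*`-homomorphisms of C*-algebras are contractive
(`IsInverseLimitAction.exists_invariant_seminorm`). Then `q̄` is invariant under `α ⊕ u`, and `q̃` is
invariant under conjugation. If `p ≤ C q`, then `p̄ ≤ √C q̄`, and iterating the C*-identity removes
the constant: `p̃ ≤ q̃` (`compactsSeminorm_le`); hence the invariant seminorms determine the topology of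
`K(A ⊕ E)`. For an invariant seminorm, continuity of orbits passes from generators to the closed
algebra, and joint continuity follows from continuity of orbits. Finally, an action on a complete
algebra whose invariant C*-seminorms determine the topology is the inverse limit of the actions on
the completions for these seminorms (`isInverseLimitAlgAction_of_invariantSeminorms`).
-/

set_option linter.unusedSectionVars false

noncomputable section

namespace LCStar

open LCStar.InnerModule (rsmul)

/-! ### Continuous C*-seminorms and their C*-completions -/

namespace CStarSeminorm

section

variable {A : Type*} [NonUnitalRing A] [StarRing A] [Module ℂ A] [TopologicalSpace A]
  (p : CStarSeminorm A)

theorem nonneg (a : A) : 0 ≤ p a := apply_nonneg p.toSeminorm a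

theorem zero : p 0 = 0 := map_zero p.toSeminorm

theorem add_le (a b : A) : p (a + b) ≤ p a + p b := map_add_le_add p.toSeminorm a b

theorem sub_le (a b : A) : p (a - b) ≤ p a + p b := map_sub_le_add p.toSeminorm a b

theorem sub_rev (a b : A) : p (a - b) = p (b - a) := map_sub_rev p.toSeminorm a b

theorem neg (a : A) : p (-a) = p a := map_neg_eq_map p.toSeminorm a

theorem smul (c : ℂ) (a : A) : p (c • a) = ‖c‖ * p a := map_smul_eq_mul p.toSeminorm c a

theorem mul_le (a b : A) : p (a * b) ≤ p a * p b := p.mul_le' a b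

theorem star_mul_self (a : A) : p (star a * a) = p a ^ 2 := p.star_mul_self' a

theorem continuous : Continuous fun a => p a := p.continuous'

theorem star_le (a : A) : p (star a) ≤ p a := by
  have h := p.star_mul_self (star a)
  rw [star_star] at h
  have h1 := p.mul_le a (star a)
  have h2 := p.nonneg (star a)
  have h3 := p.nonneg a
  rcases h2.eq_or_lt with h0 | h0
  · rw [← h0]; exact h3
  · rw [h, pow_two] at h1
    exact le_of_mul_le_mul_right h1 h0

theorem star (a : A) : p (star a) = p a :=
  le_antisymm (p.star_le a) (by simpa using p.star_le (Star.star a))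

end

end CStarSeminorm

/-- The algebra `A` regarded as a seminormed algebra through the C*-seminorm `p`. -/
def NormedBy {A : Type*} [NonUnitalRing A] [StarRing A] [Module ℂ A] [TopologicalSpace A]
    (_ : CStarSeminorm A) : Type _ := A

section NormedBy

variable {A : Type*} [NonUnitalRing A] [StarRing A] [Module ℂ A] [TopologicalSpace A]
  (p : CStarSeminorm A)

instance : NonUnitalRing (NormedBy p) := inferInstanceAs (NonUnitalRing A)
instance : StarRing (NormedBy p) := inferInstanceAs (StarRing A)
instance : Module ℂ (NormedBy p) := inferInstanceAs (Module ℂ A)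

instance : NonUnitalSeminormedRing (NormedBy p) where
  norm a := p.toFun a
  dist a b := p.toFun (-a + b)
  dist_self a := by rw [neg_add_cancel]; exact p.zero
  dist_comm a b := (p.neg _).symm.trans (congrArg p.toFun (show -(-a + b) = -b + a by abel))
  dist_triangle a b c := by
    refine le_trans (le_of_eq ?_) (p.add_le _ _)
    exact congrArg p.toFun (show -a + c = (-a + b) + (-b + c) by abel)
  dist_eq _ _ := rfl
  norm_mul_le := p.mul_le

instance : NormedSpace ℂ (NormedBy p) :=
  { (inferInstance : Module ℂ (NormedBy p)) with
    norm_smul_le := fun c a => (p.smul c a).le }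

/-- The identity map `A → NormedBy p`. -/
def toNormedBy : A →+ NormedBy p := AddMonoidHom.id A

theorem norm_normedBy_star (a : NormedBy p) : ‖star a‖ = ‖a‖ := p.star a

/-- The C*-algebra `A_p`, the Hausdorff completion of `A` with respect to `p`. -/
def CStarCompletion {A : Type*} [NonUnitalRing A] [StarRing A] [Module ℂ A]
    [TopologicalSpace A] (p : CStarSeminorm A) : Type _ :=
  UniformSpace.Completion (NormedBy p)

namespace CStarCompletion

open UniformSpace

instance : NormedAddCommGroup (CStarCompletion p) :=
  inferInstanceAs (NormedAddCommGroup (Completion (NormedBy p)))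

instance : NormedSpace ℂ (CStarCompletion p) :=
  inferInstanceAs (NormedSpace ℂ (Completion (NormedBy p)))

instance : ContinuousConstSMul ℂ (CStarCompletion p) :=
  inferInstanceAs (ContinuousConstSMul ℂ (Completion (NormedBy p)))

instance : CompleteSpace (CStarCompletion p) :=
  inferInstanceAs (CompleteSpace (Completion (NormedBy p)))

/-- The canonical map of `A` to its completion with respect to `p`. -/
def of : A → CStarCompletion p := fun a =>
  ((toNormedBy p a : NormedBy p) : Completion (NormedBy p))

theorem denseRange_of : DenseRange (of p) := Completion.denseRange_coe (α := NormedBy p)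

theorem norm_of (a : A) : ‖of p a‖ = p a :=
  (Completion.norm_coe (toNormedBy p a)).trans rfl

theorem of_add (a b : A) : of p (a + b) = of p a + of p b := Completion.coe_add (α := NormedBy p) a b

theorem of_smul (c : ℂ) (a : A) : of p (c • a) = c • of p a :=
  Completion.coe_smul (X := NormedBy p) c a

theorem of_zero : of p 0 = 0 := rfl

variable {p} in
/-- A closed condition on the completion need only be checked on the image of `A`. -/
@[elab_as_elim]
theorem induction_on {P : CStarCompletion p → Prop} (a : CStarCompletion p)
    (hP : IsClosed {a | P a}) (h : ∀ a, P (of p a)) : P a :=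
  Completion.induction_on (α := NormedBy p) a hP h

variable {p} in
@[elab_as_elim]
theorem induction_on₂ {P : CStarCompletion p → CStarCompletion p → Prop}
    (a b : CStarCompletion p)
    (hP : IsClosed {x : CStarCompletion p × CStarCompletion p | P x.1 x.2})
    (h : ∀ a b, P (of p a) (of p b)) : P a b :=
  Completion.induction_on₂ (α := NormedBy p) (β := NormedBy p) a b hP h

variable {p} in
@[elab_as_elim]
theorem induction_on₃ {P : CStarCompletion p → CStarCompletion p → CStarCompletion p → Prop}
    (a b c : CStarCompletion p)
    (hP : IsClosed {x : CStarCompletion p × CStarCompletion p × CStarCompletion p |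
      P x.1 x.2.1 x.2.2})
    (h : ∀ a b c, P (of p a) (of p b) (of p c)) : P a b c :=
  Completion.induction_on₃ (α := NormedBy p) (β := NormedBy p) (γ := NormedBy p) a b c hP h

instance : Mul (CStarCompletion p) :=
  ⟨Function.curry <| ((Completion.isDenseInducing_coe (α := NormedBy p)).prodMap
    (Completion.isDenseInducing_coe (α := NormedBy p))).extend
      ((fun a : NormedBy p => (a : Completion (NormedBy p))) ∘ Function.uncurry (· * ·))⟩

theorem of_mul (a b : A) : of p (a * b) = of p a * of p b :=
  (((Completion.isDenseInducing_coe (α := NormedBy p)).prodMap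
    (Completion.isDenseInducing_coe (α := NormedBy p))).extend_eq
      ((Completion.continuous_coe (NormedBy p)).comp
        (continuous_mul (M := NormedBy p))) (a, b)).symm

instance : ContinuousMul (CStarCompletion p) where
  continuous_mul := by
    let m := (AddMonoidHom.mul : NormedBy p →+ NormedBy p →+ NormedBy p).compr₂ Completion.toCompl
    have : Continuous fun q : NormedBy p × NormedBy p => m q.1 q.2 :=
      (Completion.continuous_coe (NormedBy p)).comp continuous_mul
    have di : IsDenseInducing (Completion.toCompl : NormedBy p → Completion (NormedBy p)) :=
      Completion.isDenseInducing_coe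
    exact di.extend_Z_bilin di this

instance : Star (CStarCompletion p) :=
  ⟨Completion.map (star : NormedBy p → NormedBy p)⟩

theorem uniformContinuous_star_normedBy : UniformContinuous (star : NormedBy p → NormedBy p) := by
  refine uniformContinuous_addMonoidHom_of_continuous
    (f := (starAddEquiv : NormedBy p ≃+ NormedBy p).toAddMonoidHom) ?_
  exact AddMonoidHomClass.continuous_of_bound
    (starAddEquiv : NormedBy p ≃+ NormedBy p).toAddMonoidHom 1
    fun a => by rw [one_mul]; exact (norm_normedBy_star p a).le

theorem of_star (a : A) : of p (star a) = star (of p a) :=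
  (Completion.map_coe (uniformContinuous_star_normedBy p) (toNormedBy p a)).symm

instance : ContinuousStar (CStarCompletion p) := ⟨Completion.continuous_map⟩

instance : NonUnitalRing (CStarCompletion p) :=
  { (inferInstance : AddCommGroup (CStarCompletion p)),
    (inferInstance : Mul (CStarCompletion p)) with
    left_distrib := fun a b c => by
      induction a, b, c using induction_on₃ with
      | hP => exact isClosed_eq (by fun_prop) (by fun_prop)
      | h a b c => simp only [← of_mul, ← of_add, mul_add]
    right_distrib := fun a b c => by
      induction a, b, c using induction_on₃ with
      | hP => exact isClosed_eq (by fun_prop) (by fun_prop)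
      | h a b c => simp only [← of_mul, ← of_add, add_mul]
    zero_mul := fun a => by
      induction a using induction_on with
      | hP => exact isClosed_eq (by fun_prop) (by fun_prop)
      | h a => rw [← of_zero, ← of_mul, zero_mul]
    mul_zero := fun a => by
      induction a using induction_on with
      | hP => exact isClosed_eq (by fun_prop) (by fun_prop)
      | h a => rw [← of_zero, ← of_mul, mul_zero]
    mul_assoc := fun a b c => by
      induction a, b, c using induction_on₃ with
      | hP => exact isClosed_eq (by fun_prop) (by fun_prop)
      | h a b c => simp only [← of_mul, mul_assoc] }

instance : NonUnitalNormedRing (CStarCompletion p) :=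
  { (inferInstance : NormedAddCommGroup (CStarCompletion p)),
    (inferInstance : NonUnitalRing (CStarCompletion p)) with
    norm_mul_le := fun a b => by
      induction a, b using induction_on₂ with
      | hP => exact isClosed_le (by fun_prop) (by fun_prop)
      | h a b => rw [← of_mul, norm_of, norm_of, norm_of]; exact p.mul_le a b }

instance : StarRing (CStarCompletion p) where
  star_involutive a := by
    induction a using induction_on with
    | hP => exact isClosed_eq (by fun_prop) (by fun_prop)
    | h a => rw [← of_star, ← of_star, star_star]
  star_mul a b := by
    induction a, b using induction_on₂ with
    | hP => exact isClosed_eq (by fun_prop) (by fun_prop)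
    | h a b => simp only [← of_mul, ← of_star, star_mul]
  star_add a b := by
    induction a, b using induction_on₂ with
    | hP => exact isClosed_eq (by fun_prop) (by fun_prop)
    | h a b => simp only [← of_add, ← of_star, star_add]

instance : CStarRing (CStarCompletion p) where
  norm_mul_self_le a := by
    induction a using induction_on with
    | hP => exact isClosed_le (by fun_prop) (by fun_prop)
    | h a => rw [← of_star, ← of_mul, norm_of, norm_of, p.star_mul_self, pow_two]

instance [IsScalarTower ℂ A A] : IsScalarTower ℂ (CStarCompletion p) (CStarCompletion p) where
  smul_assoc c a b := by
    induction a, b using induction_on₂ with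
    | hP =>
      exact isClosed_eq ((continuous_fst.const_smul c).mul continuous_snd)
        ((continuous_fst.mul continuous_snd).const_smul c)
    | h a b =>
      rw [smul_eq_mul, smul_eq_mul, ← of_smul, ← of_mul, ← of_mul, ← of_smul, smul_mul_assoc]

instance [SMulCommClass ℂ A A] : SMulCommClass ℂ (CStarCompletion p) (CStarCompletion p) where
  smul_comm c a b := by
    induction a, b using induction_on₂ with
    | hP =>
      exact isClosed_eq ((continuous_fst.mul continuous_snd).const_smul c)
        (continuous_fst.mul (continuous_snd.const_smul c))
    | h a b =>
      rw [smul_eq_mul, smul_eq_mul, ← of_smul, ← of_mul, ← of_mul, ← of_smul, mul_smul_comm]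

instance [StarModule ℂ A] : StarModule ℂ (CStarCompletion p) where
  star_smul c a := by
    induction a using induction_on with
    | hP => exact isClosed_eq (continuous_id.const_smul c).star (continuous_star.const_smul (star c))
    | h a => rw [← of_smul, ← of_star, ← of_star, ← of_smul, star_smul]

variable [IsScalarTower ℂ A A] [SMulCommClass ℂ A A] [StarModule ℂ A]

instance : NonUnitalCStarAlgebra (CStarCompletion p) where

/-- The canonical `*`-homomorphism `A → A_p`. -/
def hom : A →⋆ₙₐ[ℂ] CStarCompletion p where
  toFun := of p
  map_smul' := of_smul p
  map_zero' := rfl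
  map_add' := of_add p
  map_mul' := of_mul p
  map_star' := of_star p

theorem norm_hom (a : A) : ‖hom p a‖ = p a := norm_of p a

theorem denseRange_hom : DenseRange (hom p) := denseRange_of p

theorem norm_hom_sub (a b : A) : ‖hom p a - hom p b‖ = p (a - b) := by
  rw [← map_sub, norm_hom]

open scoped CStarAlgebra in
variable {p} in
theorem hom_ext {B : Type*} [NonUnitalCStarAlgebra B] {φ ψ : CStarCompletion p →⋆ₙₐ[ℂ] B}
    (h : ∀ a, φ (hom p a) = ψ (hom p a)) : φ = ψ := by
  ext a
  induction a using induction_on with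
  | hP => exact isClosed_eq (map_continuous φ) (map_continuous ψ)
  | h a => exact h a

section lift

variable {p} {B : Type*} [NonUnitalCStarAlgebra B] (φ : A →⋆ₙₐ[ℂ] B)

/-- The additive map underlying `lift`, before completion. -/
def preLift : NormedBy p →+ B := AddMonoidHomClass.toAddMonoidHom φ

theorem uniformContinuous_preLift (h : ∀ a, ‖φ a‖ ≤ p a) : UniformContinuous (preLift (p := p) φ) :=
  uniformContinuous_addMonoidHom_of_continuous
    (AddMonoidHomClass.continuous_of_bound (preLift (p := p) φ) 1
      fun a => (h a).trans (one_mul (p.toFun a)).ge)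

/-- The map underlying `lift`. -/
def liftFun : CStarCompletion p → B := Completion.extension (preLift (p := p) φ)

theorem continuous_liftFun : Continuous (liftFun (p := p) φ) := Completion.continuous_extension

theorem liftFun_of (h : ∀ a, ‖φ a‖ ≤ p a) (a : A) : liftFun (p := p) φ (of p a) = φ a :=
  Completion.extension_coe (uniformContinuous_preLift φ h) (toNormedBy p a)

/-- A `*`-homomorphism into a C*-algebra which is contractive for `p` extends to `A_p`. -/
def lift (h : ∀ a, ‖φ a‖ ≤ p a) : CStarCompletion p →⋆ₙₐ[ℂ] B where
  toFun := liftFun φ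
  map_smul' c a := by
    have hc := continuous_liftFun (p := p) φ
    induction a using induction_on with
    | hP => exact isClosed_eq (hc.comp (continuous_const_smul c)) (hc.const_smul c)
    | h a => rw [← of_smul, liftFun_of φ h, liftFun_of φ h, map_smul]; rfl
  map_zero' := (liftFun_of φ h 0).trans (map_zero φ)
  map_add' a b := by
    have hc := continuous_liftFun (p := p) φ
    induction a, b using induction_on₂ with
    | hP => exact isClosed_eq (by fun_prop) (by fun_prop)
    | h a b => rw [← of_add, liftFun_of φ h, liftFun_of φ h, liftFun_of φ h, map_add]
  map_mul' a b := by
    have hc := continuous_liftFun (p := p) φ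
    induction a, b using induction_on₂ with
    | hP => exact isClosed_eq (by fun_prop) (by fun_prop)
    | h a b => rw [← of_mul, liftFun_of φ h, liftFun_of φ h, liftFun_of φ h, map_mul]
  map_star' a := by
    have hc := continuous_liftFun (p := p) φ
    induction a using induction_on with
    | hP => exact isClosed_eq (by fun_prop) (by fun_prop)
    | h a => rw [← of_star, liftFun_of φ h, liftFun_of φ h, map_star]

theorem lift_hom (h : ∀ a, ‖φ a‖ ≤ p a) (a : A) : lift φ h (hom p a) = φ a := liftFun_of φ h a

end lift

instance : PartialOrder (CStarCompletion p) := CStarAlgebra.spectralOrder _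
instance : StarOrderedRing (CStarCompletion p) := CStarAlgebra.spectralOrderedRing _

/-- Positive elements of `A` have positive image in `A_p`. -/
theorem hom_nonneg {a : A} (ha : IsPositive a) : 0 ≤ hom p a := by
  refine AddSubmonoid.closure_induction (motive := fun a _ => 0 ≤ hom p a) ?_ ?_ ?_ ha
  · rintro _ ⟨b, rfl⟩
    simpa only [map_mul, map_star] using star_mul_self_nonneg (hom p b)
  · rw [map_zero]
  · intro a b _ _ ha hb
    rw [map_add]
    exact add_nonneg ha hb

end CStarCompletion

end NormedBy

/-! ### The seminorms of a Hilbert module -/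

section Seminorms

variable {A E : Type*} [NonUnitalRing A] [StarRing A] [Module ℂ A] [AddCommGroup E] [Module ℂ E]
  [InnerModule A E]

theorem inner_neg_right (ξ η : E) : inner A ξ (-η) = -inner A ξ η := by
  have h := InnerModule.inner_smul_right (A := A) (-1) ξ η
  simpa using h

theorem inner_sub_right (ξ η ζ : E) : inner A ξ (η - ζ) = inner A ξ η - inner A ξ ζ := by
  rw [sub_eq_add_neg, InnerModule.inner_add_right, inner_neg_right, sub_eq_add_neg]

theorem inner_sub_left (ξ η ζ : E) : inner A (ξ - η) ζ = inner A ξ ζ - inner A η ζ := by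
  rw [← InnerModule.star_inner, inner_sub_right, star_sub, InnerModule.star_inner,
    InnerModule.star_inner]

theorem rsmul_neg (ξ : E) (a : A) : rsmul ξ (-a) = -rsmul ξ a := by
  have h := InnerModule.rsmul_smul (A := A) (-1) ξ a
  simpa using h

theorem rsmul_sub (ξ : E) (a b : A) : rsmul ξ (a - b) = rsmul ξ a - rsmul ξ b := by
  rw [sub_eq_add_neg, InnerModule.rsmul_add, rsmul_neg, sub_eq_add_neg]

theorem sub_rsmul (ξ η : E) (a : A) : rsmul (ξ - η) a = rsmul ξ a - rsmul η a := by
  have h := InnerModule.add_rsmul (ξ - η) η a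
  rw [sub_add_cancel] at h
  exact eq_sub_of_add_eq h.symm

variable [IsScalarTower ℂ A A] [SMulCommClass ℂ A A] [StarModule ℂ A] [TopologicalSpace A]
  (p : CStarSeminorm A)

theorem moduleSeminorm_nonneg (ξ : E) : 0 ≤ moduleSeminorm p ξ := Real.sqrt_nonneg _

theorem moduleSeminorm_sq (ξ : E) : moduleSeminorm p ξ ^ 2 = p (inner A ξ ξ) :=
  Real.sq_sqrt (p.nonneg _)

theorem hom_inner_self_nonneg (ξ : E) : 0 ≤ CStarCompletion.hom p (inner A ξ ξ) :=
  CStarCompletion.hom_nonneg p (InnerModule.inner_self_pos ξ)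

/-- The Cauchy–Schwarz inequality. It follows from the positivity of `⟨ζ, ζ⟩` in the C*-algebra
`A_p` for `ζ = ξ ⟨ξ, η⟩ - t η`, with `t > p ⟨ξ, ξ⟩`. -/
theorem inner_le_moduleSeminorm_mul (ξ η : E) :
    p (inner A ξ η) ≤ moduleSeminorm p ξ * moduleSeminorm p η := by
  have key : ∀ t : ℝ, p (inner A ξ ξ) < t → p (inner A ξ η) ^ 2 ≤ t * p (inner A η η) := by
    intro t ht
    have ht0 : 0 < t := (p.nonneg _).trans_lt ht
    set a := inner A ξ η with ha
    set φ := CStarCompletion.hom p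
    have hζ : inner A (rsmul ξ a - (t : ℂ) • η) (rsmul ξ a - (t : ℂ) • η) =
        star a * inner A ξ ξ * a - (t : ℂ) • (star a * a) - (t : ℂ) • (star a * a)
          + (t : ℂ) • (t : ℂ) • inner A η η := by
      have e1 : inner A η ξ = star a := (InnerModule.star_inner ξ η).symm
      simp only [inner_sub_left, inner_sub_right, inner_rsmul_left, InnerModule.inner_rsmul_right,
        inner_smul_left, InnerModule.inner_smul_right, ← ha, e1]
      simp only [sub_mul, smul_mul_assoc, mul_assoc, smul_sub, RCLike.star_def,
        Complex.conj_ofReal]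
      abel
    have h0 : 0 ≤ φ (inner A (rsmul ξ a - (t : ℂ) • η) (rsmul ξ a - (t : ℂ) • η)) :=
      hom_inner_self_nonneg p _
    have h1 : star (φ a) * φ (inner A ξ ξ) * φ a ≤ t • (star (φ a) * φ a) := by
      refine (CStarAlgebra.star_left_conjugate_le_norm_smul
        (hb := (hom_inner_self_nonneg p ξ).isSelfAdjoint)).trans ?_
      refine smul_le_smul_of_nonneg_right ?_ (star_mul_self_nonneg _)
      rw [CStarCompletion.norm_hom]
      exact ht.le
    rw [hζ] at h0
    have hsm : ∀ b, φ ((t : ℂ) • b) = t • φ b := fun b => map_smul φ (t : ℂ) b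
    simp only [map_add, map_sub, map_mul, hsm, map_star] at h0
    have h2 : t • (star (φ a) * φ a) ≤ t • t • φ (inner A η η) := by
      have := h0.trans (add_le_add_left (sub_le_sub_right (sub_le_sub_right h1 _) _) _)
      simpa using this
    have h3 : star (φ a) * φ a ≤ t • φ (inner A η η) := (smul_le_smul_iff_of_pos_left ht0).1 h2
    have h4 := CStarAlgebra.norm_le_norm_of_nonneg_of_le (star_mul_self_nonneg _) h3
    rw [CStarRing.norm_star_mul_self, norm_smul, CStarCompletion.norm_hom,
      CStarCompletion.norm_hom, Real.norm_of_nonneg ht0.le, ← pow_two] at h4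
    exact h4
  have h5 : p (inner A ξ η) ^ 2 ≤ p (inner A ξ ξ) * p (inner A η η) := by
    refine ge_of_tendsto (x := 𝓝[>] (p (inner A ξ ξ)))
      (f := fun t => t * p (inner A η η)) ?_ (eventually_nhdsWithin_of_forall key)
    exact tendsto_nhdsWithin_of_tendsto_nhds (tendsto_id.mul_const _)
  rw [← moduleSeminorm_sq, ← moduleSeminorm_sq, ← mul_pow] at h5
  exact le_of_sq_le_sq h5 (by positivity [moduleSeminorm_nonneg p ξ, moduleSeminorm_nonneg p η])

theorem moduleSeminorm_add_le (ξ η : E) :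
    moduleSeminorm p (ξ + η) ≤ moduleSeminorm p ξ + moduleSeminorm p η := by
  have h1 := moduleSeminorm_nonneg p ξ
  have h2 := moduleSeminorm_nonneg p η
  refine abs_le_of_sq_le_sq' ?_ (add_nonneg h1 h2) |>.2
  rw [moduleSeminorm_sq, inner_add_left, InnerModule.inner_add_right, InnerModule.inner_add_right]
  have e1 := inner_le_moduleSeminorm_mul p ξ η
  have e2 := inner_le_moduleSeminorm_mul p η ξ
  have e3 := moduleSeminorm_sq p ξ
  have e4 := moduleSeminorm_sq p η
  have e5 := p.add_le (inner A ξ ξ + inner A ξ η) (inner A η ξ + inner A η η)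
  have e6 := p.add_le (inner A ξ ξ) (inner A ξ η)
  have e7 := p.add_le (inner A η ξ) (inner A η η)
  nlinarith

theorem moduleSeminorm_zero : moduleSeminorm p (0 : E) = 0 := by
  rw [moduleSeminorm, inner_zero_right, p.zero, Real.sqrt_zero]

theorem moduleSeminorm_smul (c : ℂ) (ξ : E) :
    moduleSeminorm p (c • ξ) = ‖c‖ * moduleSeminorm p ξ := by
  rw [moduleSeminorm, inner_smul_left, InnerModule.inner_smul_right, p.smul, p.smul, ← mul_assoc,
    norm_star, Real.sqrt_mul (by positivity), Real.sqrt_mul_self (norm_nonneg c)]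
  rfl

theorem moduleSeminorm_neg (ξ : E) : moduleSeminorm p (-ξ) = moduleSeminorm p ξ := by
  simpa using moduleSeminorm_smul p (-1) ξ

theorem moduleSeminorm_rsmul_le (ξ : E) (a : A) :
    moduleSeminorm p (rsmul ξ a) ≤ moduleSeminorm p ξ * p a := by
  have h1 := moduleSeminorm_nonneg p ξ
  have h2 := p.nonneg a
  refine abs_le_of_sq_le_sq' ?_ (mul_nonneg h1 h2) |>.2
  rw [moduleSeminorm_sq, inner_rsmul_left, InnerModule.inner_rsmul_right, mul_pow,
    moduleSeminorm_sq]
  refine (p.mul_le _ _).trans ?_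
  rw [p.star]
  have := mul_le_mul_of_nonneg_left (p.mul_le (inner A ξ ξ) a) h2
  linarith

/-- Vectors are approximated by their multiples `ξ e`, where `e` comes from an approximate unit of
the C*-algebra `A_p`. -/
theorem exists_moduleSeminorm_sub_rsmul_lt (ξ : E) {ε : ℝ} (hε : 0 < ε) :
    ∃ e : A, moduleSeminorm p (ξ - rsmul ξ e) < ε := by
  set h := CStarCompletion.hom p (inner A ξ ξ) with hh
  have hu := CStarAlgebra.increasingApproximateUnit (A := CStarCompletion p)
  have ht : Tendsto (fun e : CStarCompletion p => h - h * e)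
      (CStarAlgebra.approximateUnit (CStarCompletion p)) (𝓝 (h - h)) :=
    tendsto_const_nhds.sub (hu.tendsto_mul_left h)
  rw [sub_self] at ht
  have ht' := ht.norm
  rw [norm_zero] at ht'
  -- `e` has norm at most `1`; approximate it by an element of `A` of norm less than `2`
  have hopen : IsOpen {e : CStarCompletion p | ‖h - h * e‖ < ε ^ 2 / 4 ∧ ‖e‖ < 2} := by
    refine IsOpen.inter (isOpen_lt ((continuous_const.sub (continuous_const.mul continuous_id)).norm)
      continuous_const) (isOpen_lt continuous_norm continuous_const)
  have hδ' : 0 < ε ^ 2 / 4 := by positivity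
  obtain ⟨e, he, he1⟩ := ((ht'.eventually (gt_mem_nhds hδ')).and hu.eventually_norm).exists
  obtain ⟨b, hb, hb1⟩ := (CStarCompletion.denseRange_hom p).exists_mem_open hopen
    ⟨e, he, he1.trans_lt one_lt_two⟩
  refine ⟨b, abs_lt_of_sq_lt_sq' ?_ hε.le |>.2⟩
  rw [moduleSeminorm_sq]
  have e1 : inner A (ξ - rsmul ξ b) (ξ - rsmul ξ b) =
      (inner A ξ ξ - inner A ξ ξ * b) - star b * (inner A ξ ξ - inner A ξ ξ * b) := by
    simp only [inner_sub_left, inner_sub_right, inner_rsmul_left, InnerModule.inner_rsmul_right,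
      mul_sub, sub_mul, mul_assoc]
    abel
  rw [e1]
  have e2 : p (inner A ξ ξ - inner A ξ ξ * b) < ε ^ 2 / 4 := by
    rw [← CStarCompletion.norm_hom, map_sub, map_mul]; exact hb
  have e3 : p b < 2 := by rw [← CStarCompletion.norm_hom]; exact hb1
  refine (p.sub_le _ _).trans_lt ?_
  have e4 := p.mul_le (star b) (inner A ξ ξ - inner A ξ ξ * b)
  rw [p.star] at e4
  have e5 := p.nonneg (inner A ξ ξ - inner A ξ ξ * b)
  nlinarith [p.nonneg b]

/-- `p (a* a) ≤ p (a* a + ⟨ξ, ξ⟩)`, by monotonicity of the norm on positive elements. -/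
theorem le_add_of_isPositive {a b : A} (ha : IsPositive a) (hb : IsPositive b) :
    p a ≤ p (a + b) := by
  rw [← CStarCompletion.norm_hom, ← CStarCompletion.norm_hom p (a + b), map_add]
  exact CStarAlgebra.norm_le_norm_of_nonneg_of_le (CStarCompletion.hom_nonneg p ha)
    (le_add_of_nonneg_right (CStarCompletion.hom_nonneg p hb))

end Seminorms

/-! ### Convergence and completeness in terms of seminorms -/

namespace IsLocallyCStarAlgebra

variable {A : Type*} [NonUnitalRing A] [StarRing A] [Module ℂ A]
    [IsScalarTower ℂ A A] [SMulCommClass ℂ A A] [StarModule ℂ A] [UniformSpace A]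
    [IsLocallyCStarAlgebra A]

theorem tendsto_iff {ι : Type*} {l : Filter ι} {f : ι → A} {a : A} :
    Tendsto f l (𝓝 a) ↔ ∀ p : CStarSeminorm A, Tendsto (fun i => p (f i - a)) l (𝓝 0) := by
  have := IsLocallyCStarAlgebra.isUniformAddGroup (A := A)
  rw [← tendsto_sub_nhds_zero_iff, IsLocallyCStarAlgebra.nhds_zero, tendsto_iInf]
  simp only [tendsto_comap_iff]
  rfl

theorem eq_zero_of_forall {a : A} (h : ∀ p : CStarSeminorm A, p a = 0) : a = 0 := by
  have := IsLocallyCStarAlgebra.t2 (A := A)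
  refine tendsto_nhds_unique (f := fun _ : ℕ => a) (l := atTop) tendsto_const_nhds ?_
  rw [tendsto_iff]
  intro p
  simp only [sub_zero, h p, tendsto_const_nhds]

end IsLocallyCStarAlgebra

namespace HilbertModule

section

variable {A E : Type*} [NonUnitalRing A] [StarRing A] [Module ℂ A]
  [TopologicalSpace A] [AddCommGroup E] [Module ℂ E] [UniformSpace E] [InnerModule A E]
  [HilbertModule A E]

theorem tendsto_iff (A : Type*) {E : Type*} [NonUnitalRing A] [StarRing A] [Module ℂ A]
    [TopologicalSpace A] [AddCommGroup E] [Module ℂ E] [UniformSpace E] [InnerModule A E]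
    [HilbertModule A E] {ι : Type*} {l : Filter ι} {f : ι → E} {ξ : E} :
    Tendsto f l (𝓝 ξ) ↔
      ∀ p : CStarSeminorm A, Tendsto (fun i => moduleSeminorm p (f i - ξ)) l (𝓝 0) := by
  have := HilbertModule.isUniformAddGroup A (E := E)
  rw [← tendsto_sub_nhds_zero_iff, HilbertModule.nhds_zero (A := A), tendsto_iInf]
  simp only [tendsto_comap_iff]
  rfl

/-- A function which is Cauchy for every seminorm `p̄_E` converges. -/
theorem exists_tendsto {ι : Type*} {l : Filter ι} [l.NeBot] {f : ι → E}
    (h : ∀ (p : CStarSeminorm A) (ε : ℝ), 0 < ε →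
      ∃ s ∈ l, ∀ i ∈ s, ∀ j ∈ s, moduleSeminorm p (f i - f j) < ε) :
    ∃ ξ, Tendsto f l (𝓝 ξ) := by
  have := HilbertModule.isUniformAddGroup A (E := E)
  have := HilbertModule.complete A (E := E)
  have hc : Cauchy (map f l) := by
    rw [cauchy_map_iff]
    refine ⟨inferInstance, ?_⟩
    rw [uniformity_eq_comap_nhds_zero, tendsto_comap_iff, HilbertModule.nhds_zero (A := A),
      tendsto_iInf]
    intro p
    rw [tendsto_comap_iff, Metric.tendsto_nhds]
    intro ε hε
    obtain ⟨s, hs, H⟩ := h p ε hε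
    filter_upwards [prod_mem_prod hs hs] with i hi
    rw [dist_zero_right]
    exact (Real.norm_of_nonneg (Real.sqrt_nonneg _)).trans_lt (H _ hi.2 _ hi.1)
  exact CompleteSpace.complete hc

theorem eq_of_forall_inner {ξ η : E} (h : ∀ ζ, inner A ζ ξ = inner A ζ η) : ξ = η := by
  rw [← sub_eq_zero, ← HilbertModule.inner_self_eq_zero (A := A), inner_sub_right, h, sub_self]

end

section

variable {A E : Type*} [NonUnitalRing A] [StarRing A] [Module ℂ A]
    [IsScalarTower ℂ A A] [SMulCommClass ℂ A A] [StarModule ℂ A] [UniformSpace A]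
    [IsLocallyCStarAlgebra A] [AddCommGroup E] [Module ℂ E] [UniformSpace E] [InnerModule A E]
    [HilbertModule A E]

theorem eq_zero_of_forall {ξ : E} (h : ∀ p : CStarSeminorm A, moduleSeminorm p ξ = 0) : ξ = 0 := by
  rw [← HilbertModule.inner_self_eq_zero (A := A)]
  refine IsLocallyCStarAlgebra.eq_zero_of_forall fun p => ?_
  rw [← moduleSeminorm_sq, h, zero_pow two_ne_zero]

theorem t2Space (A : Type*) {E : Type*} [NonUnitalRing A] [StarRing A] [Module ℂ A]
    [IsScalarTower ℂ A A] [SMulCommClass ℂ A A] [StarModule ℂ A] [UniformSpace A]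
    [IsLocallyCStarAlgebra A] [AddCommGroup E] [Module ℂ E] [UniformSpace E] [InnerModule A E]
    [HilbertModule A E] :
    T2Space E := by
  have := HilbertModule.isUniformAddGroup A (E := E)
  refine IsTopologicalAddGroup.t2Space_of_zero_sep fun ξ hξ => ?_
  obtain ⟨p, hp⟩ : ∃ p : CStarSeminorm A, moduleSeminorm p ξ ≠ 0 := by
    by_contra! h
    exact hξ (eq_zero_of_forall h)
  have h0 : 0 < moduleSeminorm p ξ := (moduleSeminorm_nonneg p ξ).lt_of_ne' hp
  have := (HilbertModule.tendsto_iff A (f := id) (l := 𝓝 (0 : E)) (ξ := 0)).1 tendsto_id p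
  have h1 : ∀ᶠ η in 𝓝 (0 : E), moduleSeminorm p η < moduleSeminorm p ξ := by
    simpa using this.eventually (gt_mem_nhds h0)
  obtain ⟨U, hU, H⟩ := h1.exists_mem
  exact ⟨U, hU, fun h => lt_irrefl _ (H ξ h)⟩

theorem tendsto_inner {ι : Type*} {l : Filter ι} {f g : ι → E} {ξ η : E}
    (hf : Tendsto f l (𝓝 ξ)) (hg : Tendsto g l (𝓝 η)) :
    Tendsto (fun i => inner A (f i) (g i)) l (𝓝 (inner A ξ η)) := by
  rw [IsLocallyCStarAlgebra.tendsto_iff]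
  intro p
  have h1 := (HilbertModule.tendsto_iff A).1 hf p
  have h2 := (HilbertModule.tendsto_iff A).1 hg p
  have h3 := (h1.mul (h2.add_const (moduleSeminorm p η))).add (h2.const_mul (moduleSeminorm p ξ))
  simp only [zero_mul, mul_zero, add_zero] at h3
  refine squeeze_zero (fun _ => p.nonneg _) (fun i => ?_) h3
  have e : inner A (f i) (g i) - inner A ξ η =
      inner A (f i - ξ) ((g i - η) + η) + inner A ξ (g i - η) := by
    rw [sub_add_cancel, inner_sub_left, inner_sub_right]
    abel
  rw [e]
  refine (p.add_le _ _).trans (add_le_add ((inner_le_moduleSeminorm_mul p _ _).trans ?_)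
    (inner_le_moduleSeminorm_mul p _ _))
  exact mul_le_mul_of_nonneg_left (moduleSeminorm_add_le p _ _) (moduleSeminorm_nonneg p _)

theorem tendsto_const_smul (A : Type*) {E : Type*} [NonUnitalRing A] [StarRing A] [Module ℂ A]
    [IsScalarTower ℂ A A] [SMulCommClass ℂ A A] [StarModule ℂ A] [UniformSpace A]
    [IsLocallyCStarAlgebra A] [AddCommGroup E] [Module ℂ E] [UniformSpace E] [InnerModule A E]
    [HilbertModule A E]
    {ι : Type*} {l : Filter ι} {f : ι → E} {ξ : E} (h : Tendsto f l (𝓝 ξ))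
    (c : ℂ) : Tendsto (fun i => c • f i) l (𝓝 (c • ξ)) := by
  rw [HilbertModule.tendsto_iff A]
  intro p
  have h1 := ((HilbertModule.tendsto_iff A).1 h p).const_mul ‖c‖
  rw [mul_zero] at h1
  refine h1.congr fun i => ?_
  rw [← smul_sub, moduleSeminorm_smul]

end

end HilbertModule

/-! ### The topology of `L(E)` -/

namespace AdjointableOp

section

variable {A E : Type*} [NonUnitalRing A] [StarRing A] [Module ℂ A]
  [IsScalarTower ℂ A A] [SMulCommClass ℂ A A] [StarModule ℂ A] [TopologicalSpace A]
  [AddCommGroup E] [Module ℂ E] [InnerModule A E] (p q : CStarSeminorm A)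

theorem sub_op (S T : AdjointableOp A E) : (S - T).op = S.op - T.op := by
  rw [sub_eq_add_neg, sub_eq_add_neg]; rfl

theorem ofReal_le_opSeminorm (T : AdjointableOp A E) {ξ : E} (h : moduleSeminorm p ξ ≤ 1) :
    ENNReal.ofReal (moduleSeminorm p (T.op ξ)) ≤ opSeminorm p T :=
  le_iSup₂ (f := fun (ξ : E) (_ : moduleSeminorm p ξ ≤ 1) =>
    ENNReal.ofReal (moduleSeminorm p (T.op ξ))) ξ h

/-- A finite value of `p̃ (T)` bounds `T` on all vectors, also on those with `p̄_E (ξ) = 0`. -/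
theorem moduleSeminorm_op_le {T : AdjointableOp A E} (hT : opSeminorm p T ≠ ⊤) (ξ : E) :
    moduleSeminorm p (T.op ξ) ≤ (opSeminorm p T).toReal * moduleSeminorm p ξ := by
  have key : ∀ r, moduleSeminorm p ξ < r →
      moduleSeminorm p (T.op ξ) ≤ (opSeminorm p T).toReal * r := by
    intro r hr
    have hr0 : 0 < r := (moduleSeminorm_nonneg p ξ).trans_lt hr
    have hn : ‖((r⁻¹ : ℝ) : ℂ)‖ = r⁻¹ := by
      rw [Complex.norm_real, Real.norm_of_nonneg (inv_nonneg.2 hr0.le)]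
    have h1 : moduleSeminorm p (((r⁻¹ : ℝ) : ℂ) • ξ) ≤ 1 := by
      rw [moduleSeminorm_smul, hn, inv_mul_le_iff₀ hr0, mul_one]
      exact hr.le
    have h2 := (ENNReal.ofReal_le_iff_le_toReal hT).1 (ofReal_le_opSeminorm p T h1)
    rw [map_smul, moduleSeminorm_smul, hn, inv_mul_le_iff₀ hr0] at h2
    linarith
  refine ge_of_tendsto (x := 𝓝[>] (moduleSeminorm p ξ))
    (f := fun r => (opSeminorm p T).toReal * r) ?_ (eventually_nhdsWithin_of_forall key)
  exact tendsto_nhdsWithin_of_tendsto_nhds (tendsto_id.const_mul _)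

theorem opSeminorm_le_of_forall {T : AdjointableOp A E} {C : ENNReal}
    (h : ∀ ξ, moduleSeminorm p ξ ≤ 1 → ENNReal.ofReal (moduleSeminorm p (T.op ξ)) ≤ C) :
    opSeminorm p T ≤ C :=
  iSup₂_le h

theorem opSeminorm_le_ofReal {T : AdjointableOp A E} {C : ℝ} (hC : 0 ≤ C)
    (h : ∀ ξ, moduleSeminorm p (T.op ξ) ≤ C * moduleSeminorm p ξ) :
    opSeminorm p T ≤ ENNReal.ofReal C :=
  opSeminorm_le_of_forall p fun ξ hξ =>
    ENNReal.ofReal_le_ofReal ((h ξ).trans (mul_le_of_le_one_right hC hξ))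

theorem toReal_opSeminorm_le {T : AdjointableOp A E} {C : ℝ} (hC : 0 ≤ C)
    (h : ∀ ξ, moduleSeminorm p (T.op ξ) ≤ C * moduleSeminorm p ξ) :
    (opSeminorm p T).toReal ≤ C :=
  ENNReal.toReal_le_of_le_ofReal hC (opSeminorm_le_ofReal p hC h)

theorem opSeminorm_zero : opSeminorm p (0 : AdjointableOp A E) = 0 := by
  refine le_antisymm (opSeminorm_le_of_forall p fun ξ _ => ?_) zero_le
  rw [zero_op, LinearMap.zero_apply, moduleSeminorm_zero, ENNReal.ofReal_zero]

theorem opSeminorm_add_le (S T : AdjointableOp A E) :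
    opSeminorm p (S + T) ≤ opSeminorm p S + opSeminorm p T := by
  refine opSeminorm_le_of_forall p fun ξ hξ => ?_
  refine le_trans ?_ (add_le_add (ofReal_le_opSeminorm p S hξ) (ofReal_le_opSeminorm p T hξ))
  rw [← ENNReal.ofReal_add (moduleSeminorm_nonneg p _) (moduleSeminorm_nonneg p _)]
  exact ENNReal.ofReal_le_ofReal (moduleSeminorm_add_le p _ _)

theorem opSeminorm_neg (T : AdjointableOp A E) : opSeminorm p (-T) = opSeminorm p T := by
  simp only [opSeminorm, neg_op, LinearMap.neg_apply, moduleSeminorm_neg]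

theorem opSeminorm_sub_rev (S T : AdjointableOp A E) :
    opSeminorm p (S - T) = opSeminorm p (T - S) := by
  rw [← opSeminorm_neg, neg_sub]

theorem opSeminorm_sub_le (R S T : AdjointableOp A E) :
    opSeminorm p (R - T) ≤ opSeminorm p (R - S) + opSeminorm p (S - T) := by
  rw [← sub_add_sub_cancel R S T]
  exact opSeminorm_add_le p _ _

theorem tendsto_iff {ι : Type*} {l : Filter ι} {f : ι → AdjointableOp A E}
    {T : AdjointableOp A E} :
    Tendsto f l (𝓝 T) ↔
      ∀ p : CStarSeminorm A, Tendsto (fun i => opSeminorm p (f i - T)) l (𝓝 0) := by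
  have h0 : Tendsto f l (𝓝 T) ↔ ∀ (p : CStarSeminorm A) (S : AdjointableOp A E),
      Tendsto (fun i => opSeminorm p (f i - S)) l (𝓝 (opSeminorm p (T - S))) := by
    simp only [nhds_iInf, nhds_induced, tendsto_iInf, tendsto_comap_iff]
    rfl
  rw [h0]
  constructor
  · intro h p
    simpa only [sub_self, opSeminorm_zero] using h p T
  · intro h p S
    have h1 : Tendsto (fun i => opSeminorm p (T - S) - opSeminorm p (f i - T)) l
        (𝓝 (opSeminorm p (T - S))) := by
      simpa only [tsub_zero] using
        ENNReal.Tendsto.sub (tendsto_const_nhds (x := opSeminorm p (T - S))) (h p)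
          (Or.inr ENNReal.zero_ne_top)
    have h2 : Tendsto (fun i => opSeminorm p (f i - T) + opSeminorm p (T - S)) l
        (𝓝 (opSeminorm p (T - S))) := by
      simpa only [zero_add] using (h p).add (tendsto_const_nhds (x := opSeminorm p (T - S)))
    refine tendsto_of_tendsto_of_tendsto_of_le_of_le h1 h2 (fun i => ?_) (fun i => ?_)
    · refine tsub_le_iff_left.2 ?_
      rw [opSeminorm_sub_rev p (f i) T]
      exact opSeminorm_sub_le p T (f i) S
    · exact opSeminorm_sub_le p (f i) T S

/-! ### Bounded operators and the C*-seminorms of `K(E)` -/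

theorem moduleSeminorm_op_sq_le (T : AdjointableOp A E) (ξ : E) :
    moduleSeminorm p (T.op ξ) ^ 2 ≤ moduleSeminorm p ξ * moduleSeminorm p ((star T * T).op ξ) := by
  rw [moduleSeminorm_sq, T.inner_op]
  exact inner_le_moduleSeminorm_mul p _ _

theorem opSeminorm_star_le (T : AdjointableOp A E) : opSeminorm p (star T) ≤ opSeminorm p T := by
  by_cases hT : opSeminorm p T = ⊤
  · rw [hT]; exact le_top
  rw [← ENNReal.ofReal_toReal hT]
  refine opSeminorm_le_ofReal p ENNReal.toReal_nonneg fun ξ => ?_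
  have h1 := moduleSeminorm_op_sq_le p (star T) ξ
  rw [star_star] at h1
  have h2 := moduleSeminorm_op_le p hT ((star T).op ξ)
  change moduleSeminorm p ((T * star T).op ξ) ≤ _ at h2
  have h3 := moduleSeminorm_nonneg p ((star T).op ξ)
  have h4 := moduleSeminorm_nonneg p ξ
  rcases h3.eq_or_lt with h5 | h5
  · rw [← h5]; exact mul_nonneg ENNReal.toReal_nonneg h4
  · refine le_of_mul_le_mul_right ?_ h5
    nlinarith

theorem opSeminorm_star (T : AdjointableOp A E) : opSeminorm p (star T) = opSeminorm p T :=
  le_antisymm (opSeminorm_star_le p T) (by simpa using opSeminorm_star_le p (star T))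

theorem opSeminorm_mul_le {S T : AdjointableOp A E} (hS : opSeminorm p S ≠ ⊤)
    (hT : opSeminorm p T ≠ ⊤) : opSeminorm p (S * T) ≤ opSeminorm p S * opSeminorm p T := by
  rw [← ENNReal.ofReal_toReal hS, ← ENNReal.ofReal_toReal hT,
    ← ENNReal.ofReal_mul ENNReal.toReal_nonneg]
  refine opSeminorm_le_ofReal p (by positivity) fun ξ => ?_
  refine (moduleSeminorm_op_le p hS (T.op ξ)).trans ?_
  rw [mul_assoc]
  exact mul_le_mul_of_nonneg_left (moduleSeminorm_op_le p hT ξ) ENNReal.toReal_nonneg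

theorem opSeminorm_smul (c : ℂ) (T : AdjointableOp A E) :
    opSeminorm p (c • T) = ENNReal.ofReal ‖c‖ * opSeminorm p T := by
  simp only [opSeminorm, ENNReal.mul_iSup, smul_op, LinearMap.smul_apply, moduleSeminorm_smul,
    ENNReal.ofReal_mul (norm_nonneg c)]

theorem opSeminorm_sq_le {T : AdjointableOp A E} (hT : opSeminorm p (star T * T) ≠ ⊤) :
    opSeminorm p T ≠ ⊤ ∧ (opSeminorm p T).toReal ^ 2 ≤ (opSeminorm p (star T * T)).toReal := by
  have h : ∀ ξ, moduleSeminorm p (T.op ξ) ≤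
      √(opSeminorm p (star T * T)).toReal * moduleSeminorm p ξ := by
    intro ξ
    have h1 := moduleSeminorm_op_sq_le p T ξ
    have h2 := moduleSeminorm_op_le p hT ξ
    have h4 := moduleSeminorm_nonneg p ξ
    refine abs_le_of_sq_le_sq' ?_ (by positivity) |>.2
    rw [mul_pow, Real.sq_sqrt ENNReal.toReal_nonneg]
    nlinarith
  refine ⟨ne_top_of_le_ne_top ENNReal.ofReal_ne_top
    (opSeminorm_le_ofReal p (Real.sqrt_nonneg _) h), ?_⟩
  have := toReal_opSeminorm_le p (Real.sqrt_nonneg _) h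
  exact (pow_le_pow_left₀ ENNReal.toReal_nonneg this 2).trans
    (Real.sq_sqrt ENNReal.toReal_nonneg).le

theorem moduleSeminorm_rankOne_le (η ξ ζ : E) :
    moduleSeminorm p ((rankOne (A := A) η ξ).op ζ) ≤
      moduleSeminorm p η * moduleSeminorm p ξ * moduleSeminorm p ζ := by
  refine (moduleSeminorm_rsmul_le p η (inner A ξ ζ)).trans ?_
  rw [mul_assoc]
  exact mul_le_mul_of_nonneg_left (inner_le_moduleSeminorm_mul p ξ ζ) (moduleSeminorm_nonneg p η)

theorem opSeminorm_rankOne_le (η ξ : E) : opSeminorm p (rankOne (A := A) η ξ) ≤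
    ENNReal.ofReal (moduleSeminorm p η * moduleSeminorm p ξ) :=
  opSeminorm_le_ofReal p (mul_nonneg (moduleSeminorm_nonneg p η) (moduleSeminorm_nonneg p ξ))
    (moduleSeminorm_rankOne_le p η ξ)

variable (A E) in
/-- The operators on which all seminorms `p̃` are finite. -/
def bounded : NonUnitalStarSubalgebra ℂ (AdjointableOp A E) where
  carrier := {T | ∀ p : CStarSeminorm A, opSeminorm p T ≠ ⊤}
  add_mem' hS hT p := ne_top_of_le_ne_top (ENNReal.add_ne_top.2 ⟨hS p, hT p⟩)
    (opSeminorm_add_le p _ _)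
  zero_mem' p := by rw [opSeminorm_zero]; exact ENNReal.zero_ne_top
  mul_mem' hS hT p := ne_top_of_le_ne_top (ENNReal.mul_ne_top (hS p) (hT p))
    (opSeminorm_mul_le p (hS p) (hT p))
  smul_mem' c T hT p := by
    rw [opSeminorm_smul]; exact ENNReal.mul_ne_top ENNReal.ofReal_ne_top (hT p)
  star_mem' hT p := by rw [opSeminorm_star]; exact hT p

theorem isClosed_bounded : IsClosed (bounded A E : Set (AdjointableOp A E)) := by
  rw [isClosed_iff_forall_filter]
  intro T l hl hlB hlT p
  have h1 := (tendsto_iff.1 (tendsto_id'.2 hlT) p).eventually (gt_mem_nhds zero_lt_one)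
  have h2 : ∀ᶠ S in l, S ∈ bounded A E := le_principal_iff.1 hlB
  obtain ⟨S, hS1, hS2⟩ := (h1.and h2).exists
  have h3 := opSeminorm_sub_le p T S 0
  rw [sub_zero, sub_zero, opSeminorm_sub_rev] at h3
  exact ne_top_of_le_ne_top (ENNReal.add_ne_top.2 ⟨hS1.ne_top, hS2 p⟩) h3

theorem le_of_forall_pow_le_mul_pow {a b K : ℝ} (hb : 0 ≤ b)
    (h : ∀ n : ℕ, a ^ 2 ^ n ≤ K * b ^ 2 ^ n) : a ≤ b := by
  by_contra! hab
  have ha0 : 0 < a := hb.trans_lt hab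
  have h1 : Tendsto (fun n : ℕ => K * (b / a) ^ n) atTop (𝓝 (K * 0)) :=
    (tendsto_pow_atTop_nhds_zero_of_lt_one (by positivity) ((div_lt_one ha0).2 hab)).const_mul K
  have h2 : Tendsto (fun n : ℕ => 2 ^ n) atTop atTop := tendsto_pow_atTop_atTop_of_one_lt one_lt_two
  have h3 := h1.comp h2
  rw [mul_zero] at h3
  obtain ⟨n, hn⟩ := (h3.eventually (gt_mem_nhds zero_lt_one)).exists
  have h4 := h n
  simp only [Function.comp, div_pow] at hn
  rw [← mul_div_assoc, div_lt_one (by positivity)] at hn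
  exact absurd h4 (not_le.2 hn)

/-- If `p̄ ≤ C q̄` on `E`, then `p̃ ≤ q̃`. For `S = T* T` and `p̄ (ξ) ≤ 1`, repeated use of the
Cauchy–Schwarz inequality gives `p̄ (S ξ) ^ 2 ^ n ≤ p̄ (S ^ 2 ^ n ξ) ≤ C q̃ (S) ^ 2 ^ n q̄ (ξ)`, so that
the constant `C q̄ (ξ)` disappears on taking roots. -/
theorem opSeminorm_le_opSeminorm {C : ℝ} (hC : 0 ≤ C)
    (h : ∀ ξ : E, moduleSeminorm p ξ ≤ C * moduleSeminorm q ξ) (T : AdjointableOp A E) :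
    opSeminorm p T ≤ opSeminorm q T := by
  by_cases hT : opSeminorm q T = ⊤
  · rw [hT]; exact le_top
  set S := star T * T with hS
  have hSs : star S = S := by rw [hS, star_mul, star_star]
  have hqS : opSeminorm q S ≤ opSeminorm q T * opSeminorm q T := by
    refine (opSeminorm_mul_le q ?_ hT).trans_eq ?_ <;> rw [opSeminorm_star]
    exact hT
  have hqS' : opSeminorm q S ≠ ⊤ := ne_top_of_le_ne_top (ENNReal.mul_ne_top hT hT) hqS
  set b := (opSeminorm q S).toReal with hb
  have hbT : b ≤ (opSeminorm q T).toReal ^ 2 := by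
    rw [pow_two, ← ENNReal.toReal_mul]
    exact ENNReal.toReal_mono (ENNReal.mul_ne_top hT hT) hqS
  have hpow : ∀ (n : ℕ) (ξ : E), moduleSeminorm q ((S ^ n).op ξ) ≤ b ^ n * moduleSeminorm q ξ := by
    intro n ξ
    induction n with
    | zero => simp
    | succ n ih =>
      rw [pow_succ', mul_op, Module.End.mul_apply, pow_succ', mul_assoc]
      exact (moduleSeminorm_op_le q hqS' _).trans
        (mul_le_mul_of_nonneg_left ih ENNReal.toReal_nonneg)
  rw [← ENNReal.ofReal_toReal hT]
  refine opSeminorm_le_of_forall p fun ξ hξ => ENNReal.ofReal_le_ofReal ?_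
  have hiter : ∀ n : ℕ, moduleSeminorm p (S.op ξ) ^ 2 ^ n ≤ moduleSeminorm p ((S ^ 2 ^ n).op ξ) := by
    intro n
    induction n with
    | zero => simp
    | succ n ih =>
      have h1 := moduleSeminorm_op_sq_le p (S ^ 2 ^ n) ξ
      rw [star_pow, hSs, ← pow_add, ← two_mul, ← pow_succ'] at h1
      have h2 := moduleSeminorm_nonneg p ((S ^ 2 ^ (n + 1)).op ξ)
      have h3 := moduleSeminorm_nonneg p (S.op ξ)
      rw [pow_succ 2 n, pow_mul]
      calc _ ≤ moduleSeminorm p ((S ^ 2 ^ n).op ξ) ^ 2 := pow_le_pow_left₀ (by positivity) ih 2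
        _ ≤ _ := h1
        _ ≤ _ := by rw [← pow_succ 2 n]; exact mul_le_of_le_one_left h2 hξ
  have hSb : moduleSeminorm p (S.op ξ) ≤ b := by
    refine le_of_forall_pow_le_mul_pow (K := C * moduleSeminorm q ξ)
      ENNReal.toReal_nonneg fun n => ?_
    refine (hiter n).trans ((h _).trans ?_)
    have := mul_le_mul_of_nonneg_left (hpow (2 ^ n) ξ) hC
    linarith
  have h1 := moduleSeminorm_op_sq_le p T ξ
  refine abs_le_of_sq_le_sq' ?_ ENNReal.toReal_nonneg |>.2
  have h4 := moduleSeminorm_nonneg p (S.op ξ)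
  calc _ ≤ _ := h1
    _ ≤ moduleSeminorm p (S.op ξ) := mul_le_of_le_one_left h4 hξ
    _ ≤ _ := hSb.trans hbT

end

end AdjointableOp

section Closed

variable {B : Type*} [NonUnitalRing B] [StarRing B] [Module ℂ B]
  [IsScalarTower ℂ B B] [SMulCommClass ℂ B B] [StarModule ℂ B] [TopologicalSpace B]

theorem isClosed_closedStarAlgebraGenerated (s : Set B) :
    IsClosed (closedStarAlgebraGenerated s : Set B) := by
  rw [closedStarAlgebraGenerated, NonUnitalStarAlgebra.coe_sInf]
  exact isClosed_biInter fun S hS => hS.1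

theorem closedStarAlgebraGenerated_le {s : Set B} {S : NonUnitalStarSubalgebra ℂ B}
    (hS : IsClosed (S : Set B)) (h : s ⊆ S) : closedStarAlgebraGenerated s ≤ S :=
  sInf_le ⟨hS, h⟩

/-- A closed `*`-subalgebra of the closed `*`-algebra generated by `s` which contains `s` is the
whole algebra. -/
theorem closedStarAlgebraGenerated_induction {s : Set B}
    {S : NonUnitalStarSubalgebra ℂ (closedStarAlgebraGenerated s)}
    (hS : IsClosed (S : Set (closedStarAlgebraGenerated s)))
    (h : ∀ b (hb : b ∈ s), (⟨b, subset_closedStarAlgebraGenerated s hb⟩ :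
      closedStarAlgebraGenerated s) ∈ S) (b : closedStarAlgebraGenerated s) : b ∈ S := by
  have h1 : closedStarAlgebraGenerated s ≤
      S.map (NonUnitalStarSubalgebraClass.subtype (closedStarAlgebraGenerated s)) := by
    refine closedStarAlgebraGenerated_le ?_ fun b hb => ⟨_, h b hb, rfl⟩
    exact (isClosed_closedStarAlgebraGenerated s).isClosedEmbedding_subtypeVal.isClosedMap _ hS
  obtain ⟨c, hc, hcb⟩ := h1 b.2
  have : c = b := Subtype.ext hcb
  exact this ▸ hc

end Closed

section Compacts

open AdjointableOp

variable {A E : Type*} [NonUnitalRing A] [StarRing A] [Module ℂ A]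
  [IsScalarTower ℂ A A] [SMulCommClass ℂ A A] [StarModule ℂ A]

section

variable [TopologicalSpace A] [AddCommGroup E] [Module ℂ E] [InnerModule A E]
  (p q : CStarSeminorm A)

theorem compacts_le_bounded : compacts A E ≤ bounded A E := by
  refine closedStarAlgebraGenerated_le isClosed_bounded ?_
  rintro _ ⟨ξ, η, rfl⟩ p
  exact ne_top_of_le_ne_top ENNReal.ofReal_ne_top (opSeminorm_rankOne_le p ξ η)

theorem opSeminorm_compacts_ne_top (T : compacts A E) : opSeminorm p T.1 ≠ ⊤ :=
  compacts_le_bounded T.2 p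

variable (E) in
/-- The C*-seminorm `p̃` on `K(E)`, where it is finite. -/
def compactsSeminorm : CStarSeminorm (compacts A E) where
  toFun T := (opSeminorm p T.1).toReal
  map_zero' := by
    change (opSeminorm p (0 : AdjointableOp A E)).toReal = 0
    rw [opSeminorm_zero, ENNReal.toReal_zero]
  add_le' S T := by
    rw [← ENNReal.toReal_add (opSeminorm_compacts_ne_top p S) (opSeminorm_compacts_ne_top p T)]
    exact ENNReal.toReal_mono (ENNReal.add_ne_top.2
      ⟨opSeminorm_compacts_ne_top p S, opSeminorm_compacts_ne_top p T⟩) (opSeminorm_add_le p _ _)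
  neg' T := congrArg ENNReal.toReal (opSeminorm_neg p T.1)
  smul' c T := by
    change (opSeminorm p (c • T.1)).toReal = _
    rw [opSeminorm_smul, ENNReal.toReal_mul, ENNReal.toReal_ofReal (norm_nonneg c)]
  mul_le' S T := by
    rw [← ENNReal.toReal_mul]
    exact ENNReal.toReal_mono (ENNReal.mul_ne_top (opSeminorm_compacts_ne_top p S)
      (opSeminorm_compacts_ne_top p T)) (opSeminorm_mul_le p (opSeminorm_compacts_ne_top p S)
        (opSeminorm_compacts_ne_top p T))
  star_mul_self' T := by
    have hT := opSeminorm_compacts_ne_top p T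
    refine le_antisymm ?_ (opSeminorm_sq_le p (opSeminorm_compacts_ne_top p (star T * T))).2
    have h := opSeminorm_mul_le p (S := star T.1) (T := T.1) (by rwa [opSeminorm_star]) hT
    rw [opSeminorm_star] at h
    have h2 := ENNReal.toReal_mono (ENNReal.mul_ne_top hT hT) h
    rwa [ENNReal.toReal_mul, ← pow_two] at h2
  continuous' := by
    refine continuous_iff_continuousAt.2 fun T => ?_
    refine (ENNReal.tendsto_toReal (opSeminorm_compacts_ne_top p T)).comp ?_
    have h : Continuous fun T : AdjointableOp A E => opSeminorm p (T - 0) :=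
      continuous_iff_le_induced.2 (iInf₂_le p 0)
    simp only [sub_zero] at h
    exact (h.comp continuous_subtype_val).tendsto T

theorem moduleSeminorm_compacts_le (T : compacts A E) (ξ : E) :
    moduleSeminorm p (T.1.op ξ) ≤ compactsSeminorm E p T * moduleSeminorm p ξ :=
  moduleSeminorm_op_le p (opSeminorm_compacts_ne_top p T) ξ

theorem compacts_tendsto_iff {ι : Type*} {l : Filter ι} {f : ι → compacts A E}
    {T : compacts A E} : Tendsto f l (𝓝 T) ↔
      ∀ p : CStarSeminorm A, Tendsto (fun i => compactsSeminorm E p (f i - T)) l (𝓝 0) := by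
  rw [tendsto_subtype_rng, AdjointableOp.tendsto_iff]
  refine forall_congr' fun p => ?_
  exact (ENNReal.tendsto_toReal_iff (fun i => opSeminorm_compacts_ne_top p (f i - T))
    ENNReal.zero_ne_top).symm

theorem compactsSeminorm_le {C : ℝ} (hC : 0 ≤ C)
    (h : ∀ ξ : E, moduleSeminorm p ξ ≤ C * moduleSeminorm q ξ) (T : compacts A E) :
    compactsSeminorm E p T ≤ compactsSeminorm E q T :=
  ENNReal.toReal_mono (opSeminorm_compacts_ne_top q T) (opSeminorm_le_opSeminorm p q hC h T.1)

end

section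

variable [UniformSpace A] [IsLocallyCStarAlgebra A] [AddCommGroup E] [Module ℂ E] [UniformSpace E]
  [InnerModule A E] [HilbertModule A E]

theorem AdjointableOp.ext_op {S T : AdjointableOp A E} (h : ∀ ξ, S.op ξ = T.op ξ) : S = T := by
  refine AdjointableOp.ext (LinearMap.ext h) (LinearMap.ext fun η => ?_)
  refine HilbertModule.eq_of_forall_inner (A := A) fun ζ => ?_
  rw [← S.inner_op, ← T.inner_op, h]

theorem AdjointableOp.eq_zero_of_forall {T : AdjointableOp A E}
    (h : ∀ p : CStarSeminorm A, opSeminorm p T = 0) : T = 0 := by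
  refine AdjointableOp.ext_op fun ξ => HilbertModule.eq_zero_of_forall (A := A) fun p => ?_
  have h1 := moduleSeminorm_op_le p (T := T) (by rw [h p]; exact ENNReal.zero_ne_top) ξ
  rw [h p, ENNReal.toReal_zero, zero_mul] at h1
  exact le_antisymm h1 (moduleSeminorm_nonneg p _)

instance : T2Space (AdjointableOp A E) := by
  refine t2_iff_nhds.2 fun {S T} h => ?_
  refine sub_eq_zero.1 (AdjointableOp.eq_zero_of_forall (A := A) fun p => ?_)
  have h1 : Tendsto id (𝓝 S ⊓ 𝓝 T) (𝓝 S) := tendsto_id'.2 inf_le_left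
  have h2 : Tendsto id (𝓝 S ⊓ 𝓝 T) (𝓝 T) := tendsto_id'.2 inf_le_right
  have h3 := (AdjointableOp.tendsto_iff.1 h1 p).add (AdjointableOp.tendsto_iff.1 h2 p)
  rw [add_zero] at h3
  refine le_antisymm (ge_of_tendsto' h3 fun R => ?_) zero_le
  rw [opSeminorm_sub_rev p (id R) S]
  exact opSeminorm_sub_le p S R T

/-- `K(E)` is complete: limits of Cauchy nets are computed pointwise, for the operators and for
their adjoints. -/
theorem compacts_exists_tendsto {ι : Type*} {l : Filter ι} [l.NeBot] {f : ι → compacts A E}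
    (h : ∀ (p : CStarSeminorm A) (ε : ℝ), 0 < ε →
      ∃ s ∈ l, ∀ i ∈ s, ∀ j ∈ s, compactsSeminorm E p (f i - f j) < ε) :
    ∃ T, Tendsto f l (𝓝 T) := by
  have hE := HilbertModule.isUniformAddGroup A (E := E)
  have hT2 := HilbertModule.t2Space A (E := E)
  have hA2 := IsLocallyCStarAlgebra.t2 (A := A)
  have hptw : ∀ (g : ι → compacts A E), (∀ (p : CStarSeminorm A) (ε : ℝ), 0 < ε →
      ∃ s ∈ l, ∀ i ∈ s, ∀ j ∈ s, compactsSeminorm E p (g i - g j) < ε) →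
      ∀ ξ, ∃ η, Tendsto (fun i => (g i).1.op ξ) l (𝓝 η) := by
    intro g hg ξ
    refine HilbertModule.exists_tendsto (A := A) fun p ε hε => ?_
    have h0 := moduleSeminorm_nonneg p ξ
    obtain ⟨s, hs, H⟩ := hg p (ε / (moduleSeminorm p ξ + 1)) (by positivity)
    refine ⟨s, hs, fun i hi j hj => ?_⟩
    have h1 := moduleSeminorm_compacts_le p (g i - g j) ξ
    have h2 := H i hi j hj
    rw [lt_div_iff₀ (by positivity)] at h2
    have h3 : (g i - g j).1.op ξ = (g i).1.op ξ - (g j).1.op ξ := by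
      change ((g i).1 - (g j).1).op ξ = _
      rw [sub_op, LinearMap.sub_apply]
    rw [h3] at h1
    have h4 := (compactsSeminorm E p).nonneg (g i - g j)
    nlinarith
  choose t ht using hptw f h
  choose t' ht' using hptw (fun i => star (f i)) (fun p ε hε => by
    obtain ⟨s, hs, H⟩ := h p ε hε
    refine ⟨s, hs, fun i hi j hj => ?_⟩
    have e1 : star (f i) - star (f j) = star (f i - f j) := (star_sub _ _).symm
    rw [e1, CStarSeminorm.star]
    exact H i hi j hj)
  have mkLin : ∀ (g : ι → compacts A E) (τ : E → E),
      (∀ ξ, Tendsto (fun i => (g i).1.op ξ) l (𝓝 (τ ξ))) → ∃ L : E →ₗ[ℂ] E, ∀ ξ, L ξ = τ ξ :=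
    fun g τ hτ => ⟨{
      toFun := τ
      map_add' := fun ξ η => tendsto_nhds_unique (hτ (ξ + η)) (by
        simpa only [map_add] using (hτ ξ).add (hτ η))
      map_smul' := fun c ξ => tendsto_nhds_unique (hτ (c • ξ)) (by
        simpa only [map_smul, RingHom.id_apply] using HilbertModule.tendsto_const_smul A (hτ ξ) c) },
      fun _ => rfl⟩
  obtain ⟨L, hL⟩ := mkLin f t ht
  obtain ⟨L', hL'⟩ := mkLin _ t' ht'
  let T : AdjointableOp A E :=
    { op := L
      adj := L'
      inner_op := fun ξ η => by
        rw [hL, hL']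
        refine tendsto_nhds_unique (HilbertModule.tendsto_inner (A := A) (ht ξ)
          (tendsto_const_nhds (x := η))) ?_
        refine (HilbertModule.tendsto_inner (A := A) (tendsto_const_nhds (x := ξ))
          (ht' η)).congr fun i => ?_
        exact ((f i).1.inner_op ξ η).symm }
  have hlim : Tendsto (fun i => (f i).1) l (𝓝 T) := by
    rw [AdjointableOp.tendsto_iff]
    intro p
    rw [ENNReal.tendsto_nhds_zero]
    intro ε hε
    obtain ⟨δ, hδ0, hδ⟩ := ENNReal.lt_iff_exists_real_btwn.1 hε
    have hδ1 : 0 < δ := ENNReal.ofReal_pos.1 hδ.1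
    obtain ⟨s, hs, H⟩ := h p δ hδ1
    filter_upwards [hs] with i hi
    refine (opSeminorm_le_ofReal p hδ1.le fun ξ => ?_).trans hδ.2.le
    have hlim1 := ((HilbertModule.tendsto_iff A).1 (ht ξ) p).const_add (δ * moduleSeminorm p ξ)
    rw [add_zero] at hlim1
    refine ge_of_tendsto hlim1 ?_
    filter_upwards [hs] with j hj
    have e1 : ((f i).1 - T).op ξ = (f i - f j).1.op ξ + ((f j).1.op ξ - t ξ) := by
      change ((f i).1 - T).op ξ = ((f i).1 - (f j).1).op ξ + _
      rw [sub_op, sub_op, LinearMap.sub_apply, LinearMap.sub_apply, ← hL]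
      exact (sub_add_sub_cancel _ _ _).symm
    rw [e1]
    refine (moduleSeminorm_add_le p _ _).trans (add_le_add_left ?_ _)
    refine (moduleSeminorm_compacts_le p (f i - f j) ξ).trans ?_
    exact mul_le_mul_of_nonneg_right (H i hi j hj).le (moduleSeminorm_nonneg p ξ)
  have hmem : T ∈ compacts A E :=
    (isClosed_closedStarAlgebraGenerated _).mem_of_tendsto hlim
      (Eventually.of_forall fun i => (f i).2)
  exact ⟨⟨T, hmem⟩, tendsto_subtype_rng.2 hlim⟩

end

end Compacts

/-! ### Suprema of C*-seminorms and closures -/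

section Sup

variable {A : Type*} [NonUnitalRing A] [StarRing A] [Module ℂ A] [TopologicalSpace A]

instance : Zero (CStarSeminorm A) where
  zero :=
    { (0 : Seminorm ℂ A) with
      mul_le' := fun a b => by
        change (0 : ℝ) ≤ 0 * 0
        rw [mul_zero]
      star_mul_self' := fun a => by
        change (0 : ℝ) = 0 ^ 2
        rw [zero_pow two_ne_zero]
      continuous' := continuous_const }

instance : Max (CStarSeminorm A) where
  max p q :=
    { p.toSeminorm ⊔ q.toSeminorm with
      mul_le' := fun a b => by
        change max (p (a * b)) (q (a * b)) ≤ max (p a) (q a) * max (p b) (q b)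
        exact max_le
          ((p.mul_le a b).trans (mul_le_mul (le_max_left _ _) (le_max_left _ _) (p.nonneg b)
            (le_max_of_le_left (p.nonneg a))))
          ((q.mul_le a b).trans (mul_le_mul (le_max_right _ _) (le_max_right _ _) (q.nonneg b)
            (le_max_of_le_left (p.nonneg a))))
      star_mul_self' := fun a => by
        change max (p (star a * a)) (q (star a * a)) = max (p a) (q a) ^ 2
        rw [p.star_mul_self, q.star_mul_self]
        rcases le_total (p a) (q a) with h | h
        · rw [max_eq_right h, max_eq_right (pow_le_pow_left₀ (p.nonneg a) h 2)]
        · rw [max_eq_left h, max_eq_left (pow_le_pow_left₀ (q.nonneg a) h 2)]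
      continuous' := p.continuous.max q.continuous }

theorem CStarSeminorm.sup_apply (p q : CStarSeminorm A) (a : A) :
    (p ⊔ q) a = max (p a) (q a) := rfl

theorem moduleSeminorm_le_of_le {E : Type*} [AddCommGroup E] [Module ℂ E] [InnerModule A E]
    {p q : CStarSeminorm A} {C : ℝ} (hC : 0 ≤ C) (h : ∀ a, p a ≤ C * q a) (ξ : E) :
    moduleSeminorm p ξ ≤ √C * moduleSeminorm q ξ := by
  rw [moduleSeminorm, moduleSeminorm, ← Real.sqrt_mul hC]
  exact Real.sqrt_le_sqrt (h _)

end Sup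

section Closure

open AdjointableOp

variable {A E : Type*} [NonUnitalRing A] [StarRing A] [Module ℂ A]
  [IsScalarTower ℂ A A] [SMulCommClass ℂ A A] [StarModule ℂ A] [TopologicalSpace A]
  [AddCommGroup E] [Module ℂ E] [InnerModule A E]

theorem opSeminorm_le_opSeminorm_of_le {p q : CStarSeminorm A} (h : ∀ a, p a ≤ q a)
    (T : AdjointableOp A E) : opSeminorm p T ≤ opSeminorm q T :=
  opSeminorm_le_opSeminorm p q (Real.sqrt_nonneg 1)
    (moduleSeminorm_le_of_le zero_le_one (by simpa using h)) T

/-- Membership in a closure may be tested with one seminorm at a time, since the seminorms `p̃` are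
directed. -/
theorem mem_closure_of_forall_opSeminorm_lt {s : Set (AdjointableOp A E)} {T : AdjointableOp A E}
    (h : ∀ (p : CStarSeminorm A) (ε : ENNReal), 0 < ε → ∃ S ∈ s, opSeminorm p (S - T) < ε) :
    T ∈ closure s := by
  let l : CStarSeminorm A → Filter (AdjointableOp A E) := fun p =>
    comap (fun S => opSeminorm p (S - T)) (𝓝 0) ⊓ 𝓟 s
  have hdir : Directed (· ≥ ·) l := by
    intro p q
    have hle : ∀ r r' : CStarSeminorm A, (∀ a, r a ≤ r' a) → l r' ≤ l r := by
      intro r r' hr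
      refine inf_le_inf_right _ ?_
      rw [← tendsto_iff_comap]
      exact tendsto_of_tendsto_of_tendsto_of_le_of_le tendsto_const_nhds tendsto_comap
        (fun _ => zero_le) fun S => opSeminorm_le_opSeminorm_of_le hr (S - T)
    exact ⟨p ⊔ q, hle _ _ fun a => le_max_left _ _, hle _ _ fun a => le_max_right _ _⟩
  have hne : ∀ p, (l p).NeBot := by
    intro p
    rw [inf_principal_neBot_iff]
    intro U hU
    obtain ⟨V, hV, hVU⟩ := mem_comap.1 hU
    obtain ⟨ε, hε, hεV⟩ := ENNReal.nhds_zero_basis.mem_iff.1 hV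
    obtain ⟨S, hS, hSε⟩ := h p ε hε
    exact ⟨S, hVU (hεV hSε), hS⟩
  have : Nonempty (CStarSeminorm A) := ⟨0⟩
  have hbot : (⨅ p, l p).NeBot := iInf_neBot_of_directed' hdir hne
  refine mem_closure_of_tendsto (f := id) (b := ⨅ p, l p) ?_ ?_
  · rw [AdjointableOp.tendsto_iff]
    intro p
    exact tendsto_comap.mono_left ((iInf_le _ p).trans inf_le_left)
  · exact ((iInf_le l 0).trans inf_le_right) (mem_principal_self s)

end Closure

/-! ### The direct sum `A ⊕ E` and the linking algebra -/

section DirectSum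

variable {A E : Type*} [NonUnitalRing A] [StarRing A] [Module ℂ A] [IsScalarTower ℂ A A]
  [SMulCommClass ℂ A A] [StarModule ℂ A]

theorem directSum_inner [AddCommGroup E] [Module ℂ E] [InnerModule A E] (x y : A × E) :
    inner A x y = star x.1 * y.1 + inner A x.2 y.2 := rfl

theorem directSum_rsmul [AddCommGroup E] [Module ℂ E] [InnerModule A E] (x : A × E) (a : A) :
    rsmul x a = (x.1 * a, rsmul x.2 a) := rfl

section

variable [TopologicalSpace A] [AddCommGroup E] [Module ℂ E] [InnerModule A E]
  (p : CStarSeminorm A)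

theorem isPositive_star_mul_self (a : A) : IsPositive (star a * a) :=
  AddSubmonoid.subset_closure ⟨a, rfl⟩

theorem le_moduleSeminorm_directSum (x : A × E) : p x.1 ≤ moduleSeminorm p x := by
  refine abs_le_of_sq_le_sq' ?_ (moduleSeminorm_nonneg p x) |>.2
  rw [moduleSeminorm_sq, directSum_inner, ← p.star_mul_self]
  exact le_add_of_isPositive p (isPositive_star_mul_self x.1) (InnerModule.inner_self_pos x.2)

theorem moduleSeminorm_snd_le (x : A × E) : moduleSeminorm p x.2 ≤ moduleSeminorm p x := by
  refine abs_le_of_sq_le_sq' ?_ (moduleSeminorm_nonneg p x) |>.2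
  rw [moduleSeminorm_sq, moduleSeminorm_sq, directSum_inner, add_comm]
  exact le_add_of_isPositive p (InnerModule.inner_self_pos x.2) (isPositive_star_mul_self x.1)

theorem moduleSeminorm_directSum_le (x : A × E) :
    moduleSeminorm p x ≤ p x.1 + moduleSeminorm p x.2 := by
  have h1 := p.nonneg x.1
  have h2 := moduleSeminorm_nonneg p x.2
  refine abs_le_of_sq_le_sq' ?_ (add_nonneg h1 h2) |>.2
  rw [moduleSeminorm_sq, directSum_inner]
  refine (p.add_le _ _).trans ?_
  rw [p.star_mul_self, ← moduleSeminorm_sq]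
  nlinarith

end

section

variable [UniformSpace A] [IsLocallyCStarAlgebra A] [AddCommGroup E] [Module ℂ E] [UniformSpace E]
  [InnerModule A E] [HilbertModule A E]

instance : HilbertModule A (A × E) where
  inner_self_eq_zero x := by
    refine ⟨fun h => ?_, fun h => by rw [h, inner_zero_right]⟩
    have h0 : ∀ p : CStarSeminorm A, moduleSeminorm p x = 0 := fun p => by
      rw [moduleSeminorm, h, p.zero, Real.sqrt_zero]
    refine Prod.ext (IsLocallyCStarAlgebra.eq_zero_of_forall fun p => ?_)
      (HilbertModule.eq_zero_of_forall (A := A) fun p => ?_)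
    · exact le_antisymm ((le_moduleSeminorm_directSum p x).trans_eq (h0 p)) (p.nonneg _)
    · exact le_antisymm ((moduleSeminorm_snd_le p x).trans_eq (h0 p)) (moduleSeminorm_nonneg p _)
  isUniformAddGroup := by
    have := IsLocallyCStarAlgebra.isUniformAddGroup (A := A)
    have := HilbertModule.isUniformAddGroup A (E := E)
    infer_instance
  nhds_zero := by
    refine le_antisymm ?_ ?_
    · refine le_iInf fun p => ?_
      rw [← tendsto_iff_comap]
      have h1 : Tendsto (fun x : A × E => p x.1) (𝓝 0) (𝓝 0) := by
        have := IsLocallyCStarAlgebra.tendsto_iff.1 ((continuous_fst (X := A) (Y := E)).tendsto 0) p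
        simpa only [Prod.fst_zero, sub_zero] using this
      have h2 : Tendsto (fun x : A × E => moduleSeminorm p x.2) (𝓝 0) (𝓝 0) := by
        have := (HilbertModule.tendsto_iff A).1 ((continuous_snd (X := A) (Y := E)).tendsto 0) p
        simpa only [Prod.snd_zero, sub_zero] using this
      have h3 := h1.add h2
      rw [add_zero] at h3
      exact squeeze_zero (fun x => moduleSeminorm_nonneg p x) (moduleSeminorm_directSum_le p) h3
    · have h0 : ∀ p : CStarSeminorm A, Tendsto (fun x : A × E => moduleSeminorm p x)
          (⨅ p : CStarSeminorm A, comap (fun x : A × E => moduleSeminorm p x) (𝓝 0)) (𝓝 0) :=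
        fun p => tendsto_comap.mono_left (iInf_le _ p)
      rw [← tendsto_id', show (0 : A × E) = (0, 0) from rfl, nhds_prod_eq]
      refine Tendsto.prodMk (m₁ := fun x : A × E => x.1) (m₂ := fun x : A × E => x.2) ?_ ?_
      · refine IsLocallyCStarAlgebra.tendsto_iff.2 fun p => ?_
        simp only [sub_zero]
        exact squeeze_zero (fun _ => p.nonneg _) (le_moduleSeminorm_directSum p) (h0 p)
      · refine (HilbertModule.tendsto_iff A).2 fun p => ?_
        simp only [sub_zero]
        exact squeeze_zero (fun _ => moduleSeminorm_nonneg p _) (moduleSeminorm_snd_le p) (h0 p)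
  complete := by
    have := IsLocallyCStarAlgebra.complete (A := A)
    have := HilbertModule.complete A (E := E)
    infer_instance

open AdjointableOp

theorem linkingOp_op_apply (a : A) (ξ η : E) (T : AdjointableOp A E) (x : A × E) :
    (linkingOp a ξ η T).op x = (a * x.1 + inner A ξ x.2, rsmul η x.1 + T.op x.2) := rfl

theorem rankOne_op_apply {F : Type*} [AddCommGroup F] [Module ℂ F] [InnerModule A F]
    (η ξ ζ : F) : (rankOne (A := A) η ξ).op ζ = rsmul η (inner A ξ ζ) := rfl

theorem rankOne_directSum (x y : A × E) : rankOne (A := A) x y =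
    linkingOp (x.1 * star y.1) (rsmul y.2 (star x.1)) (rsmul x.2 (star y.1))
      (rankOne x.2 y.2) := by
  refine AdjointableOp.ext_op fun z => ?_
  rw [linkingOp_op_apply, rankOne_op_apply, rankOne_op_apply, directSum_rsmul, directSum_inner,
    mul_add, InnerModule.rsmul_add, inner_rsmul_left, star_star, ← mul_assoc,
    InnerModule.rsmul_mul]

theorem compacts_le_linkingAlgebra : compacts A (A × E) ≤ linkingAlgebra A E := by
  refine closedStarAlgebraGenerated_le (isClosed_closedStarAlgebraGenerated _) ?_
  rintro _ ⟨x, y, rfl⟩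
  rw [rankOne_directSum]
  exact subset_closedStarAlgebraGenerated _ ⟨_, _, _, theta x.2 y.2, rfl⟩

theorem zero_rsmul {F : Type*} [AddCommGroup F] [Module ℂ F] [InnerModule A F] (a : A) :
    rsmul (0 : F) a = 0 := by
  have h := InnerModule.smul_rsmul 0 (0 : F) a
  simpa using h

theorem linkingOp_corner_op_apply (T : AdjointableOp A E) (x : A × E) :
    (linkingOp 0 0 0 T).op x = (0, T.op x.2) := by
  rw [linkingOp_op_apply, zero_mul, inner_zero_left, zero_rsmul, zero_add, zero_add]

variable (A E) in
/-- The embedding `T ↦ 0 ⊕ T` of `L(E)` in `L(A ⊕ E)`. -/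
def cornerHom : AdjointableOp A E →⋆ₙₐ[ℂ] AdjointableOp A (A × E) where
  toFun T := linkingOp 0 0 0 T
  map_smul' c T := ext_op fun x => by simp [linkingOp_corner_op_apply]
  map_zero' := ext_op fun x => by simp [linkingOp_corner_op_apply]
  map_add' S T := ext_op fun x => by simp [linkingOp_corner_op_apply]
  map_mul' S T := ext_op fun x => by simp [linkingOp_corner_op_apply]
  map_star' T := AdjointableOp.ext (LinearMap.ext fun x => by simp [linkingOp])
    (LinearMap.ext fun x => by simp [linkingOp])

theorem cornerHom_op_apply (T : AdjointableOp A E) (x : A × E) :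
    (cornerHom A E T).op x = (0, T.op x.2) := linkingOp_corner_op_apply T x

theorem continuous_cornerHom : Continuous (cornerHom A E) := by
  refine continuous_iff_continuousAt.2 fun T => AdjointableOp.tendsto_iff.2 fun p => ?_
  refine tendsto_of_tendsto_of_tendsto_of_le_of_le tendsto_const_nhds
    (AdjointableOp.tendsto_iff.1 (tendsto_id (x := 𝓝 T)) p) (fun _ => zero_le) fun S => ?_
  rw [← map_sub]
  refine opSeminorm_le_of_forall p fun x hx => ?_
  refine le_trans (ENNReal.ofReal_le_ofReal ?_)
    (ofReal_le_opSeminorm p (S - T) ((moduleSeminorm_snd_le p x).trans hx))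
  rw [cornerHom_op_apply]
  exact (moduleSeminorm_directSum_le p _).trans_eq (by rw [p.zero, zero_add])

theorem cornerHom_mem_compacts {T : AdjointableOp A E} (hT : T ∈ compacts A E) :
    cornerHom A E T ∈ compacts A (A × E) := by
  refine closedStarAlgebraGenerated_le
    (S := (compacts A (A × E)).comap (cornerHom A E)) ?_ ?_ hT
  · exact (isClosed_closedStarAlgebraGenerated _).preimage continuous_cornerHom
  · rintro _ ⟨ξ, η, rfl⟩
    have h : cornerHom A E (rankOne ξ η) = rankOne (A := A) ((0, ξ) : A × E) (0, η) := by
      refine ext_op fun x => ?_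
      rw [cornerHom_op_apply, rankOne_op_apply, rankOne_op_apply, directSum_rsmul, directSum_inner,
        star_zero, zero_mul, zero_mul, zero_add]
    change cornerHom A E (rankOne ξ η) ∈ compacts A (A × E)
    rw [h]
    exact (theta ((0, ξ) : A × E) (0, η)).2

/-- The operators `c ⊕ ζ ↦ x c`, for `x ∈ A ⊕ E`, are limits of rank one operators
`θ_{x, e* ⊕ 0}`, where `x e` approximates `x`. -/
theorem linkingOp_column_mem_compacts (a : A) (η : E) :
    linkingOp a 0 η 0 ∈ compacts A (A × E) := by
  refine (isClosed_closedStarAlgebraGenerated _).closure_subset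
    (mem_closure_of_forall_opSeminorm_lt fun p ε hε => ?_)
  obtain ⟨δ, hδ0, hδ⟩ := ENNReal.lt_iff_exists_real_btwn.1 hε
  have hδ1 : 0 < δ := ENNReal.ofReal_pos.1 hδ.1
  obtain ⟨e, he⟩ := exists_moduleSeminorm_sub_rsmul_lt p ((a, η) : A × E) hδ1
  refine ⟨rankOne (a, η) (star e, 0), (theta ((a, η) : A × E) (star e, 0)).2,
    lt_of_le_of_lt (opSeminorm_le_ofReal p hδ1.le fun x => ?_) hδ.2⟩
  have e1 : (rankOne (A := A) ((a, η) : A × E) (star e, 0) - linkingOp a 0 η 0).op x =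
      -rsmul (((a, η) : A × E) - rsmul ((a, η) : A × E) e) x.1 := by
    have h0 : inner A (0 : E) x.2 = 0 := inner_zero_left x.2
    rw [sub_op, LinearMap.sub_apply, rankOne_op_apply, linkingOp_op_apply, directSum_inner, h0,
      star_star, add_zero, add_zero, sub_rsmul, neg_sub, InnerModule.rsmul_mul, zero_op,
      LinearMap.zero_apply, add_zero]
    rfl
  rw [e1, moduleSeminorm_neg]
  refine (moduleSeminorm_rsmul_le p _ _).trans ?_
  exact mul_le_mul he.le (le_moduleSeminorm_directSum p x) (p.nonneg _) hδ1.le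

theorem linkingOp_eq (a : A) (ξ η : E) (T : AdjointableOp A E) :
    linkingOp a ξ η T = linkingOp a 0 η 0 + star (linkingOp 0 0 ξ 0) + cornerHom A E T := by
  refine ext_op fun x => ?_
  have h : (star (linkingOp 0 0 ξ 0)).op x = (inner A ξ x.2, 0) := by
    change (star 0 * x.1 + inner A ξ x.2, rsmul 0 x.1 + (0 : AdjointableOp A E).adj x.2) = _
    rw [star_zero, zero_mul, zero_add, zero_rsmul, zero_adj, LinearMap.zero_apply, zero_add]
  rw [add_op, add_op, LinearMap.add_apply, LinearMap.add_apply, h, cornerHom_op_apply,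
    linkingOp_op_apply, linkingOp_op_apply, inner_zero_left, zero_op, LinearMap.zero_apply,
    Prod.mk_add_mk, Prod.mk_add_mk, add_zero, add_zero, add_zero, add_zero]

theorem linkingAlgebra_eq_compacts : linkingAlgebra A E = compacts A (A × E) := by
  refine le_antisymm (closedStarAlgebraGenerated_le (isClosed_closedStarAlgebraGenerated _) ?_)
    compacts_le_linkingAlgebra
  rintro _ ⟨a, ξ, η, T, rfl⟩
  rw [linkingOp_eq]
  exact add_mem (add_mem (linkingOp_column_mem_compacts a η)
    (star_mem (linkingOp_column_mem_compacts 0 ξ))) (cornerHom_mem_compacts T.2)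

end

end DirectSum

/-! ### Automorphisms of Hilbert modules and conjugation of operators -/

/-- The C*-seminorm `p ∘ α`. -/
def CStarSeminorm.comp {A : Type*} [NonUnitalRing A] [StarRing A] [Module ℂ A] [TopologicalSpace A]
    (p : CStarSeminorm A) (α : A →⋆ₙₐ[ℂ] A) (hα : Continuous α) : CStarSeminorm A where
  toFun a := p (α a)
  map_zero' := by rw [map_zero]; exact p.zero
  add_le' a b := by rw [map_add]; exact p.add_le _ _
  neg' a := by rw [map_neg]; exact p.neg _
  smul' c a := by rw [map_smul]; exact p.smul _ _
  mul_le' a b := by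
    rw [map_mul]; exact p.mul_le _ _
  star_mul_self' a := by
    rw [map_mul, map_star]; exact p.star_mul_self _
  continuous' := p.continuous.comp hα

namespace HilbertAut

section

variable {A E : Type*} [NonUnitalRing A] [StarRing A] [Module ℂ A]
  [IsScalarTower ℂ A A] [SMulCommClass ℂ A A] [StarModule ℂ A] [UniformSpace A]
  [AddCommGroup E] [Module ℂ E] [UniformSpace E]
  [InnerModule A E] [HilbertModule A E]

theorem eq_of_forall_inner_apply (u : HilbertAut A E) {ξ η : E}
    (h : ∀ ζ, inner A (u.1 ζ) ξ = inner A (u.1 ζ) η) : ξ = η :=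
  HilbertModule.eq_of_forall_inner (A := A) fun ζ => by simpa using h (u.1.symm ζ)

/-- Automorphisms preserve the linear structure: inner products determine sums and multiples. -/
def toLinearMap (u : HilbertAut A E) : E →ₗ[ℂ] E where
  toFun := u.1
  map_add' ξ η := by
    obtain ⟨α, -, hα⟩ := u.2.1
    refine eq_of_forall_inner_apply u fun ζ => ?_
    rw [hα, InnerModule.inner_add_right, InnerModule.inner_add_right, hα, hα, map_add]
  map_smul' c ξ := by
    obtain ⟨α, -, hα⟩ := u.2.1
    refine eq_of_forall_inner_apply u fun ζ => ?_
    rw [RingHom.id_apply, hα, InnerModule.inner_smul_right, InnerModule.inner_smul_right, hα,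
      map_smul]

theorem map_rsmul (u : HilbertAut A E) {α : A →⋆ₙₐ[ℂ] A}
    (hα : ∀ ξ η : E, inner A (u.1 ξ) (u.1 η) = α (inner A ξ η)) (ξ : E) (a : A) :
    u.1 (rsmul ξ a) = rsmul (u.1 ξ) (α a) := by
  refine eq_of_forall_inner_apply u fun ζ => ?_
  rw [hα, InnerModule.inner_rsmul_right, InnerModule.inner_rsmul_right, hα, map_mul]

theorem apply_inv_apply (u : HilbertAut A E) (ξ : E) : u.1 (u⁻¹.1 ξ) = ξ :=
  u.1.apply_symm_apply ξ

theorem inv_apply_apply (u : HilbertAut A E) (ξ : E) : u⁻¹.1 (u.1 ξ) = ξ :=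
  u.1.symm_apply_apply ξ

theorem mul_apply (u v : HilbertAut A E) (ξ : E) : (u * v).1 ξ = u.1 (v.1 ξ) := rfl

theorem inner_apply_left (u : HilbertAut A E) {α : A →⋆ₙₐ[ℂ] A}
    (hα : ∀ ξ η : E, inner A (u.1 ξ) (u.1 η) = α (inner A ξ η)) (ξ η : E) :
    inner A (u.1 ξ) η = α (inner A ξ (u⁻¹.1 η)) := by
  rw [← hα, apply_inv_apply]

theorem inner_apply_right (u : HilbertAut A E) {α : A →⋆ₙₐ[ℂ] A}
    (hα : ∀ ξ η : E, inner A (u.1 ξ) (u.1 η) = α (inner A ξ η)) (ξ η : E) :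
    inner A ξ (u.1 η) = α (inner A (u⁻¹.1 ξ) η) := by
  rw [← hα, apply_inv_apply]

theorem moduleSeminorm_apply (u : HilbertAut A E) {α : A →⋆ₙₐ[ℂ] A} (hc : Continuous α)
    (hα : ∀ ξ η : E, inner A (u.1 ξ) (u.1 η) = α (inner A ξ η)) (p : CStarSeminorm A) (ξ : E) :
    moduleSeminorm p (u.1 ξ) = moduleSeminorm (p.comp α hc) ξ := by
  rw [moduleSeminorm, hα]; rfl

/-- The operator `u T u⁻¹`. -/
def conj (u : HilbertAut A E) (T : AdjointableOp A E) : AdjointableOp A E where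
  op := (toLinearMap u) ∘ₗ T.op ∘ₗ (toLinearMap u⁻¹)
  adj := (toLinearMap u) ∘ₗ T.adj ∘ₗ (toLinearMap u⁻¹)
  inner_op ξ η := by
    obtain ⟨α, -, hα⟩ := u.2.1
    change inner A (u.1 (T.op (u⁻¹.1 ξ))) η = inner A ξ (u.1 (T.adj (u⁻¹.1 η)))
    rw [inner_apply_left u hα, inner_apply_right u hα, T.inner_op]

end

section

open AdjointableOp

variable {A E : Type*} [NonUnitalRing A] [StarRing A] [Module ℂ A]
  [IsScalarTower ℂ A A] [SMulCommClass ℂ A A] [StarModule ℂ A] [UniformSpace A]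
  [IsLocallyCStarAlgebra A] [AddCommGroup E] [Module ℂ E] [UniformSpace E]
  [InnerModule A E] [HilbertModule A E]

/-- Conjugation by `u` as a `*`-homomorphism of `L(E)`. -/
def conjHom (u : HilbertAut A E) : AdjointableOp A E →⋆ₙₐ[ℂ] AdjointableOp A E where
  toFun := (conj u)
  map_smul' c T := ext_op fun ξ => (toLinearMap u).map_smul c _
  map_zero' := ext_op fun ξ => (toLinearMap u).map_zero
  map_add' S T := ext_op fun ξ => (toLinearMap u).map_add _ _
  map_mul' S T := ext_op fun ξ => by
    change u.1 (S.op (T.op (u⁻¹.1 ξ))) = u.1 (S.op (u⁻¹.1 (u.1 (T.op (u⁻¹.1 ξ)))))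
    rw [inv_apply_apply]
  map_star' T := rfl

theorem conjHom_op_apply (u : HilbertAut A E) (T : AdjointableOp A E) (ξ : E) :
    (conjHom u T).op ξ = u.1 (T.op (u⁻¹.1 ξ)) := rfl

theorem conjHom_mul (u v : HilbertAut A E) (T : AdjointableOp A E) :
    conjHom (u * v) T = conjHom u (conjHom v T) := by
  refine ext_op fun ξ => ?_
  simp only [conjHom_op_apply, mul_inv_rev, mul_apply]

theorem conjHom_one (T : AdjointableOp A E) : conjHom (1 : HilbertAut A E) T = T :=
  ext_op fun ξ => by
    rw [conjHom_op_apply, inv_one]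
    rfl

theorem conjHom_rankOne (u : HilbertAut A E) (ξ η : E) :
    conjHom u (rankOne (A := A) ξ η) = rankOne (u.1 ξ) (u.1 η) := by
  obtain ⟨α, -, hα⟩ := u.2.1
  refine ext_op fun ζ => ?_
  rw [conjHom_op_apply, rankOne_op_apply, rankOne_op_apply, map_rsmul u hα, ← hα, apply_inv_apply]

theorem opSeminorm_conjHom_le (u : HilbertAut A E) {α : A →⋆ₙₐ[ℂ] A} (hc : Continuous α)
    (hα : ∀ ξ η : E, inner A (u.1 ξ) (u.1 η) = α (inner A ξ η)) (p : CStarSeminorm A)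
    (T : AdjointableOp A E) : opSeminorm p (conjHom u T) ≤ opSeminorm (p.comp α hc) T := by
  refine opSeminorm_le_of_forall p fun ξ hξ => ?_
  rw [conjHom_op_apply, moduleSeminorm_apply u hc hα]
  refine ofReal_le_opSeminorm _ T ?_
  rwa [← moduleSeminorm_apply u hc hα, apply_inv_apply]

theorem continuous_conjHom (u : HilbertAut A E) : Continuous (conjHom u) := by
  obtain ⟨α, hc, hα⟩ := u.2.1
  refine continuous_iff_continuousAt.2 fun T => AdjointableOp.tendsto_iff.2 fun p => ?_
  refine tendsto_of_tendsto_of_tendsto_of_le_of_le tendsto_const_nhds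
    (AdjointableOp.tendsto_iff.1 (tendsto_id (x := 𝓝 T)) (p.comp α hc)) (fun _ => zero_le)
    fun S => ?_
  rw [← map_sub]
  exact opSeminorm_conjHom_le u hc hα p _

theorem conjHom_mem_compacts (u : HilbertAut A E) {T : AdjointableOp A E}
    (hT : T ∈ compacts A E) : conjHom u T ∈ compacts A E := by
  refine closedStarAlgebraGenerated_le (S := (compacts A E).comap (conjHom u)) ?_ ?_ hT
  · exact (isClosed_closedStarAlgebraGenerated _).preimage (continuous_conjHom u)
  · rintro _ ⟨ξ, η, rfl⟩
    change conjHom u (rankOne ξ η) ∈ compacts A E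
    rw [conjHom_rankOne]
    exact (theta (u.1 ξ) (u.1 η)).2

/-- Conjugation by `u` as an automorphism of `K(E)`. -/
def compactsEquiv (u : HilbertAut A E) : compacts A E ≃⋆ₐ[ℂ] compacts A E where
  toFun T := ⟨conjHom u T.1, conjHom_mem_compacts u T.2⟩
  invFun T := ⟨conjHom u⁻¹ T.1, conjHom_mem_compacts u⁻¹ T.2⟩
  left_inv T := Subtype.ext (by
    change conjHom u⁻¹ (conjHom u T.1) = T.1
    rw [← conjHom_mul, inv_mul_cancel, conjHom_one])
  right_inv T := Subtype.ext (by
    change conjHom u (conjHom u⁻¹ T.1) = T.1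
    rw [← conjHom_mul, mul_inv_cancel, conjHom_one])
  map_mul' S T := Subtype.ext (map_mul (conjHom u) S.1 T.1)
  map_add' S T := Subtype.ext (map_add (conjHom u) S.1 T.1)
  map_star' T := Subtype.ext (map_star (conjHom u) T.1)
  map_smul' c T := Subtype.ext (map_smul (conjHom u) c T.1)

theorem continuous_compactsEquiv (u : HilbertAut A E) : Continuous (compactsEquiv u) :=
  ((continuous_conjHom u).comp continuous_subtype_val).subtype_mk _

variable (A E) in
/-- The action of `Aut(E)` on `K(E)` by conjugation. -/
def onCompacts : HilbertAut A E →* AlgAut (compacts A E) where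
  toFun u := ⟨compactsEquiv u, continuous_compactsEquiv u, continuous_compactsEquiv u⁻¹⟩
  map_one' := Subtype.ext (StarAlgEquiv.ext fun T => Subtype.ext (conjHom_one T.1))
  map_mul' u v := Subtype.ext (StarAlgEquiv.ext fun T => Subtype.ext (conjHom_mul u v T.1))

theorem onCompacts_apply (u : HilbertAut A E) (T : compacts A E) :
    ((onCompacts A E u).1 T).1 = conjHom u T.1 := rfl

theorem onCompacts_theta (u : HilbertAut A E) (ξ η : E) :
    (onCompacts A E u).1 (theta ξ η) = theta (u.1 ξ) (u.1 η) :=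
  Subtype.ext (conjHom_rankOne u ξ η)

end

end HilbertAut

/-! ### Uniqueness of the induced automorphisms -/

section Uniqueness

/-- Two automorphisms of the closed `*`-algebra generated by `s` which agree on `s` are equal. -/
theorem AlgAut.ext_of_generators {B : Type*} [NonUnitalRing B] [StarRing B] [Module ℂ B]
    [IsScalarTower ℂ B B] [SMulCommClass ℂ B B] [StarModule ℂ B] [TopologicalSpace B] [T2Space B]
    {s : Set B} {f g : AlgAut (closedStarAlgebraGenerated s)}
    (h : ∀ b (hb : b ∈ s), f.1 ⟨b, subset_closedStarAlgebraGenerated s hb⟩ =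
      g.1 ⟨b, subset_closedStarAlgebraGenerated s hb⟩) : f = g := by
  -- the subalgebra on which `f` and `g` agree
  let S : NonUnitalStarSubalgebra ℂ (closedStarAlgebraGenerated s) :=
    { carrier := {b | f.1 b = g.1 b}
      add_mem' := fun {a b} ha hb => by
        change f.1 (a + b) = g.1 (a + b)
        rw [map_add, map_add, ha, hb]
      zero_mem' := by
        change f.1 0 = g.1 0
        rw [map_zero, map_zero]
      mul_mem' := fun {a b} ha hb => by
        change f.1 (a * b) = g.1 (a * b)
        rw [map_mul, map_mul, ha, hb]
      smul_mem' := fun c a ha => by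
        change f.1 (c • a) = g.1 (c • a)
        rw [map_smul, map_smul, ha]
      star_mem' := fun {a} ha => by
        change f.1 (star a) = g.1 (star a)
        rw [map_star, map_star, ha] }
  have hS : IsClosed (S : Set (closedStarAlgebraGenerated s)) := isClosed_eq f.2.1 g.2.1
  exact Subtype.ext (StarAlgEquiv.ext fun b => closedStarAlgebraGenerated_induction hS h b)

variable {A E : Type*} [NonUnitalRing A] [StarRing A] [Module ℂ A]
  [IsScalarTower ℂ A A] [SMulCommClass ℂ A A] [StarModule ℂ A] [UniformSpace A]
  [IsLocallyCStarAlgebra A] [AddCommGroup E] [Module ℂ E] [UniformSpace E]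
  [InnerModule A E] [HilbertModule A E]

theorem compacts_algAut_ext {f g : AlgAut (compacts A E)}
    (h : ∀ ξ η : E, f.1 (theta ξ η) = g.1 (theta ξ η)) : f = g := by
  refine AlgAut.ext_of_generators ?_
  rintro _ ⟨ξ, η, rfl⟩
  exact h ξ η

end Uniqueness

section Full

variable {A E : Type*} [NonUnitalRing A] [StarRing A] [Module ℂ A] [TopologicalSpace A]
  [AddCommGroup E] [Module ℂ E] [InnerModule A E]

/-- When `E` is full, continuous `*`-homomorphisms on `A` are determined by their values on inner
products. -/
theorem IsFull.hom_ext (hfull : IsFull A E) {B : Type*} [NonUnitalRing B] [StarRing B] [Module ℂ B]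
    [TopologicalSpace B] [T2Space B] {φ ψ : A →⋆ₙₐ[ℂ] B} (hφ : Continuous φ) (hψ : Continuous ψ)
    (h : ∀ ξ η : E, φ (inner A ξ η) = ψ (inner A ξ η)) (a : A) : φ a = ψ a := by
  refine congrFun (Continuous.ext_on hfull hφ hψ fun b hb => ?_) a
  refine Submodule.span_induction (p := fun b _ => φ b = ψ b) ?_ ?_ ?_ ?_ hb
  · rintro _ ⟨ξ, η, rfl⟩
    exact h ξ η
  · rw [map_zero, map_zero]
  · intro a b _ _ ha hb
    rw [map_add, map_add, ha, hb]
  · intro c a _ ha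
    rw [map_smul, map_smul, ha]

/-- An endomorphism `α` of `A` with `⟨uξ, uη⟩ = α⟨ξ, η⟩`. It is chosen arbitrarily, and is unique if
`E` is full. -/
def HilbertAut.algHom (u : HilbertAut A E) : A →⋆ₙₐ[ℂ] A := u.2.1.choose

theorem HilbertAut.continuous_algHom (u : HilbertAut A E) : Continuous (HilbertAut.algHom u) :=
  u.2.1.choose_spec.1

theorem HilbertAut.inner_apply_apply (u : HilbertAut A E) (ξ η : E) :
    inner A (u.1 ξ) (u.1 η) = HilbertAut.algHom u (inner A ξ η) :=
  u.2.1.choose_spec.2 ξ η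

variable [T2Space A]

theorem HilbertAut.algHom_mul (hfull : IsFull A E) (u v : HilbertAut A E) (a : A) :
    HilbertAut.algHom (u * v) a = HilbertAut.algHom u (HilbertAut.algHom v a) := by
  refine hfull.hom_ext (ψ := (HilbertAut.algHom u).comp (HilbertAut.algHom v))
    (HilbertAut.continuous_algHom (u * v))
    ((HilbertAut.continuous_algHom u).comp (HilbertAut.continuous_algHom v)) (fun ξ η => ?_) a
  change _ = HilbertAut.algHom u (HilbertAut.algHom v (inner A ξ η))
  rw [← HilbertAut.inner_apply_apply, ← HilbertAut.inner_apply_apply,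
    ← HilbertAut.inner_apply_apply]
  rfl

theorem HilbertAut.algHom_one (hfull : IsFull A E) (a : A) :
    HilbertAut.algHom (1 : HilbertAut A E) a = a :=
  hfull.hom_ext (ψ := NonUnitalStarAlgHom.id ℂ A)
    (HilbertAut.continuous_algHom (1 : HilbertAut A E))
    continuous_id (fun ξ η => ((HilbertAut.inner_apply_apply (1 : HilbertAut A E)) ξ η).symm) a

/-- The action of `Aut(E)` on `A`, for a full Hilbert module `E`. -/
def HilbertAut.onAlgebra (hfull : IsFull A E) : HilbertAut A E →* AlgAut A where
  toFun u := ⟨{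
      toFun := HilbertAut.algHom u
      invFun := HilbertAut.algHom u⁻¹
      left_inv := fun a => by
        rw [← HilbertAut.algHom_mul hfull, inv_mul_cancel, HilbertAut.algHom_one hfull]
      right_inv := fun a => by
        rw [← HilbertAut.algHom_mul hfull, mul_inv_cancel, HilbertAut.algHom_one hfull]
      map_mul' := map_mul (HilbertAut.algHom u)
      map_add' := map_add (HilbertAut.algHom u)
      map_star' := map_star (HilbertAut.algHom u)
      map_smul' := map_smul (HilbertAut.algHom u) },
    HilbertAut.continuous_algHom u, HilbertAut.continuous_algHom u⁻¹⟩
  map_one' := Subtype.ext (StarAlgEquiv.ext (HilbertAut.algHom_one hfull))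
  map_mul' u v := Subtype.ext (StarAlgEquiv.ext (HilbertAut.algHom_mul hfull u v))

theorem HilbertAut.onAlgebra_inner (hfull : IsFull A E) (u : HilbertAut A E) (ξ η : E) :
    (HilbertAut.onAlgebra hfull u).1 (inner A ξ η) = inner A (u.1 ξ) (u.1 η) :=
  ((HilbertAut.inner_apply_apply u) ξ η).symm

/-- An automorphism of `A` as a `*`-homomorphism. -/
def AlgAut.toHom (f : AlgAut A) : A →⋆ₙₐ[ℂ] A where
  toFun := f.1
  map_smul' := map_smul f.1
  map_zero' := map_zero f.1
  map_add' := map_add f.1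
  map_mul' := map_mul f.1
  map_star' := map_star f.1

theorem IsFull.algAut_ext (hfull : IsFull A E) {f g : AlgAut A}
    (h : ∀ ξ η : E, f.1 (inner A ξ η) = g.1 (inner A ξ η)) : f = g :=
  Subtype.ext (StarAlgEquiv.ext fun a =>
    hfull.hom_ext (φ := AlgAut.toHom f) (ψ := AlgAut.toHom g) f.2.1 g.2.1 h a)

end Full

/-! ### The action on the direct sum -/

section DirectSumAction

variable {G A E : Type*} [Group G] [NonUnitalRing A] [StarRing A] [Module ℂ A]
  [IsScalarTower ℂ A A] [SMulCommClass ℂ A A] [StarModule ℂ A] [UniformSpace A]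
  [AddCommGroup E] [Module ℂ E] [UniformSpace E] [InnerModule A E]
  {u : G →* HilbertAut A E} {α : G →* AlgAut A}

theorem isHilbertMorphism_directSum (hα : IsInducedOnAlgebra u α) (g : G) :
    IsHilbertMorphism A A fun x : A × E => ((α g).1 x.1, (u g).1 x.2) := by
  refine ⟨AlgAut.toHom (α g), (α g).2.1, fun x y => ?_⟩
  change star ((α g).1 x.1) * (α g).1 y.1 + inner A ((u g).1 x.2) ((u g).1 y.2) =
    (α g).1 (star x.1 * y.1 + inner A x.2 y.2)
  rw [map_add, map_mul, map_star, hα]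

/-- The action `α ⊕ u` on the Hilbert module `A ⊕ E`. -/
def directSumAction (hα : IsInducedOnAlgebra u α) : G →* HilbertAut A (A × E) where
  toFun g := ⟨{
      toFun := fun x => ((α g).1 x.1, (u g).1 x.2)
      invFun := fun x => ((α g⁻¹).1 x.1, (u g⁻¹).1 x.2)
      left_inv := fun x => by
        rw [map_inv, map_inv]
        exact Prod.ext ((α g).1.symm_apply_apply x.1) ((u g).1.symm_apply_apply x.2)
      right_inv := fun x => by
        rw [map_inv, map_inv]
        exact Prod.ext ((α g).1.apply_symm_apply x.1) ((u g).1.apply_symm_apply x.2) },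
    isHilbertMorphism_directSum hα g, isHilbertMorphism_directSum hα g⁻¹⟩
  map_one' := Subtype.ext (Equiv.ext fun x => by
    change ((α 1).1 x.1, (u 1).1 x.2) = x
    rw [map_one, map_one]; rfl)
  map_mul' g h := Subtype.ext (Equiv.ext fun x => by
    change ((α (g * h)).1 x.1, (u (g * h)).1 x.2) = _
    rw [map_mul, map_mul]; rfl)

theorem directSumAction_apply (hα : IsInducedOnAlgebra u α) (g : G) (x : A × E) :
    (directSumAction hα g).1 x = ((α g).1 x.1, (u g).1 x.2) := rfl

variable [IsLocallyCStarAlgebra A] [HilbertModule A E]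

theorem conjHom_directSumAction_linkingOp (hα : IsInducedOnAlgebra u α) (g : G) (a : A) (ξ η : E)
    (T : AdjointableOp A E) :
      HilbertAut.conjHom (directSumAction hα g) (linkingOp a ξ η T) =
        linkingOp ((α g).1 a) ((u g).1 ξ) ((u g).1 η) ((HilbertAut.conjHom (u g)) T) := by
  have h1 : ∀ b, (α g).1 ((α g⁻¹).1 b) = b := fun b => by
    rw [map_inv]; exact (α g).1.apply_symm_apply b
  have h2 : ∀ ζ, (u g).1 ((u g⁻¹).1 ζ) = ζ := fun ζ => by
    rw [map_inv]; exact (u g).1.apply_symm_apply ζ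
  have h3 : ∀ (ζ : E) (b : A), (u g).1 (rsmul ζ b) = rsmul ((u g).1 ζ) ((α g).1 b) :=
    HilbertAut.map_rsmul (u g) (α := AlgAut.toHom (α g)) fun ξ η => (hα g ξ η).symm
  have h4 : ∀ ζ ζ', (u g).1 (ζ + ζ') = (u g).1 ζ + (u g).1 ζ' :=
    (HilbertAut.toLinearMap (u g)).map_add
  refine AdjointableOp.ext_op fun x => ?_
  rw [HilbertAut.conjHom_op_apply, ← map_inv, directSumAction_apply, directSumAction_apply,
    linkingOp_op_apply, linkingOp_op_apply, map_add, map_mul, h1, hα, h2, h4, h3, h1,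
    HilbertAut.conjHom_op_apply, ← map_inv]

end DirectSumAction

/-! ### Inverse limits over the invariant seminorms -/

instance {A : Type*} [NonUnitalRing A] [StarRing A] [Module ℂ A] [TopologicalSpace A] :
    Preorder (CStarSeminorm A) :=
  Preorder.lift fun p => (p.toFun : A → ℝ)

section InvariantSeminorms

variable {G : Type*} [Group G] {B : Type u} [NonUnitalRing B] [StarRing B] [Module ℂ B]
  [TopologicalSpace B] (γ : G →* AlgAut B)

/-- The continuous C*-seminorms which are invariant under the action `γ`. -/
abbrev InvariantSeminorm : Type u :=
  {r : CStarSeminorm B // ∀ (g : G) (b : B), r ((γ g).1 b) = r b}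

instance : Nonempty (InvariantSeminorm γ) := ⟨⟨0, fun _ _ => rfl⟩⟩

instance : IsDirectedOrder (InvariantSeminorm γ) where
  directed r s := ⟨⟨r.1 ⊔ s.1, fun g b => by
      rw [CStarSeminorm.sup_apply, CStarSeminorm.sup_apply, r.2, s.2]⟩,
    fun _ => le_max_left _ _, fun _ => le_max_right _ _⟩

variable [IsScalarTower ℂ B B] [SMulCommClass ℂ B B] [StarModule ℂ B]

/-- The C*-completions of `B` with respect to the invariant seminorms, with the canonical maps. -/
def invariantSystem : CStarSystem.{u, u} (InvariantSeminorm γ) where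
  alg r := CStarCompletion r.1
  map {l m} h := CStarCompletion.lift (CStarCompletion.hom m.1)
    fun b => (CStarCompletion.norm_hom m.1 b).trans_le (h b)
  map_self l a := DFunLike.congr_fun (CStarCompletion.hom_ext (ψ := NonUnitalStarAlgHom.id ℂ _)
    fun b => CStarCompletion.lift_hom _ _ b) a
  map_map {l m n} h h' a := by
    refine DFunLike.congr_fun (CStarCompletion.hom_ext (φ := (CStarCompletion.lift
      (CStarCompletion.hom n.1) fun b => (CStarCompletion.norm_hom n.1 b).trans_le (h' b)).comp
        (CStarCompletion.lift (CStarCompletion.hom m.1)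
          fun b => (CStarCompletion.norm_hom m.1 b).trans_le (h b))) fun b => ?_) a
    rw [NonUnitalStarAlgHom.comp_apply, CStarCompletion.lift_hom, CStarCompletion.lift_hom,
      CStarCompletion.lift_hom]

theorem invariantSystem_map_hom {l m : InvariantSeminorm γ} (h : m ≤ l) (b : B) :
    (invariantSystem γ).map h (CStarCompletion.hom l.1 b) = CStarCompletion.hom m.1 b :=
  CStarCompletion.lift_hom (CStarCompletion.hom m.1)
    (fun b => (CStarCompletion.norm_hom m.1 b).trans_le (h b)) b

/-- The endomorphism of the completion `B_r` induced by `γ g`. -/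
def completionHom (r : InvariantSeminorm γ) (g : G) :
    CStarCompletion r.1 →⋆ₙₐ[ℂ] CStarCompletion r.1 :=
  CStarCompletion.lift ((CStarCompletion.hom r.1).comp (AlgAut.toHom (γ g)))
    fun b => (CStarCompletion.norm_hom r.1 _).trans_le (r.2 g b).le

theorem completionHom_hom (r : InvariantSeminorm γ) (g : G) (b : B) :
    completionHom γ r g (CStarCompletion.hom r.1 b) = CStarCompletion.hom r.1 ((γ g).1 b) :=
  CStarCompletion.lift_hom _ _ b

theorem completionHom_mul (r : InvariantSeminorm γ) (g h : G) (a : CStarCompletion r.1) :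
    completionHom γ r (g * h) a = completionHom γ r g (completionHom γ r h a) := by
  refine DFunLike.congr_fun (CStarCompletion.hom_ext
    (ψ := (completionHom γ r g).comp (completionHom γ r h)) fun b => ?_) a
  rw [NonUnitalStarAlgHom.comp_apply, completionHom_hom, completionHom_hom, completionHom_hom,
    map_mul]
  rfl

theorem completionHom_one (r : InvariantSeminorm γ) (a : CStarCompletion r.1) :
    completionHom γ r 1 a = a := by
  refine DFunLike.congr_fun (CStarCompletion.hom_ext
    (ψ := NonUnitalStarAlgHom.id ℂ _) fun b => ?_) a
  rw [completionHom_hom, map_one]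
  rfl

open scoped CStarAlgebra in
/-- The action on the completion `B_r` induced by `γ`. -/
def completionAction (r : InvariantSeminorm γ) : G →* AlgAut (CStarCompletion r.1) where
  toFun g := ⟨{
      toFun := completionHom γ r g
      invFun := completionHom γ r g⁻¹
      left_inv := fun a => by rw [← completionHom_mul, inv_mul_cancel, completionHom_one]
      right_inv := fun a => by rw [← completionHom_mul, mul_inv_cancel, completionHom_one]
      map_mul' := map_mul (completionHom γ r g)
      map_add' := map_add (completionHom γ r g)
      map_star' := map_star (completionHom γ r g)
      map_smul' := map_smul (completionHom γ r g) },
    map_continuous (completionHom γ r g), map_continuous (completionHom γ r g⁻¹)⟩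
  map_one' := Subtype.ext (StarAlgEquiv.ext (completionHom_one γ r))
  map_mul' g h := Subtype.ext (StarAlgEquiv.ext (completionHom_mul γ r g h))

theorem CStarSeminorm.continuous_sub [ContinuousSub B] (r : CStarSeminorm B) (b : B) :
    Continuous fun x => r (x - b) :=
  r.continuous.comp (continuous_id.sub continuous_const)

theorem CStarCompletion.continuous_hom [ContinuousSub B] (r : CStarSeminorm B) :
    Continuous (CStarCompletion.hom r) := by
  refine continuous_iff_continuousAt.2 fun b => tendsto_iff_norm_sub_tendsto_zero.2 ?_
  simp only [CStarCompletion.norm_hom_sub]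
  have h := (r.continuous_sub b).tendsto b
  rwa [sub_self, r.zero] at h

open scoped CStarAlgebra in
/-- If the invariant C*-seminorms determine the topology of the complete Hausdorff algebra `B`, then
`B` is the inverse limit of its completions with respect to these. -/
theorem invariantSystem_isLimit [ContinuousSub B] [T2Space B]
    (hgen : ∀ (l : Filter B) (b : B),
      (∀ r : InvariantSeminorm γ, Tendsto (fun x => r.1 (x - b)) l (𝓝 0)) → l ≤ 𝓝 b)
    (hcomplete : ∀ (l : Filter B) [l.NeBot], (∀ (r : InvariantSeminorm γ) (ε : ℝ), 0 < ε →
      ∃ s ∈ l, ∀ x ∈ s, ∀ y ∈ s, r.1 (x - y) < ε) → ∃ b, l ≤ 𝓝 b) :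
    (invariantSystem γ).IsLimit fun r => CStarCompletion.hom r.1 where
  coherent h a := invariantSystem_map_hom γ h a
  existsUnique b hb := by
    -- A coherent family `b` is approximated by the filter of those elements of `B` whose images in
    -- all completions are close to `b`; this filter is Cauchy, and its limit is the preimage of `b`.
    let l : InvariantSeminorm γ → Filter B := fun r =>
      comap (CStarCompletion.hom r.1) (𝓝 (b r))
    have hdir : Directed (· ≥ ·) l := by
      refine directed_of_isDirected_le fun m n hmn => ?_
      change comap _ _ ≤ comap _ _
      rw [← tendsto_iff_comap, ← hb hmn]
      have h1 : Continuous ((invariantSystem γ).map hmn) := map_continuous _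
      refine ((h1.tendsto (b n)).comp tendsto_comap).congr fun x => ?_
      exact invariantSystem_map_hom γ hmn x
    have hne : ∀ r, (l r).NeBot := fun r =>
      comap_neBot fun t ht =>
        let ⟨_, hx, a, ha⟩ := mem_closure_iff_nhds.1 (CStarCompletion.denseRange_hom r.1 (b r)) t ht
        ⟨a, ha.symm ▸ hx⟩
    have hbot : (⨅ r, l r).NeBot := iInf_neBot_of_directed' hdir hne
    have hlim : ∀ r : InvariantSeminorm γ,
        Tendsto (CStarCompletion.hom r.1) (⨅ r, l r) (𝓝 (b r)) :=
      fun r => tendsto_comap.mono_left (iInf_le _ r)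
    obtain ⟨a, ha⟩ := hcomplete (⨅ r, l r) fun r ε hε => by
      refine ⟨_, hlim r (Metric.ball_mem_nhds (b r) (half_pos hε)), fun x hx y hy => ?_⟩
      rw [← CStarCompletion.norm_hom_sub, ← dist_eq_norm]
      have h1 : dist (CStarCompletion.hom r.1 x) (b r) < ε / 2 := hx
      have h2 : dist (CStarCompletion.hom r.1 y) (b r) < ε / 2 := hy
      have h3 := dist_triangle_right (CStarCompletion.hom r.1 x) (CStarCompletion.hom r.1 y) (b r)
      linarith
    refine ⟨a, fun r => tendsto_nhds_unique (X := CStarCompletion r.1)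
      (((CStarCompletion.continuous_hom r.1).tendsto a).mono_left ha) (hlim r), fun a' ha' => ?_⟩
    refine (tendsto_nhds_unique (f := id) (l := ⨅ r, l r) ha (hgen _ _ fun r => ?_)).symm
    simp only [← CStarCompletion.norm_hom_sub]
    refine tendsto_iff_norm_sub_tendsto_zero.1 ?_
    have e : CStarCompletion.hom r.1 a' = b r := ha' r
    rw [e]
    exact hlim r
  topology_eq := by
    refine le_antisymm (le_iInf fun r =>
      continuous_iff_le_induced.1 (CStarCompletion.continuous_hom r.1)) ?_
    rw [le_iff_nhds]
    intro b
    refine hgen _ b fun r => ?_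
    simp only [← CStarCompletion.norm_hom_sub]
    refine tendsto_iff_norm_sub_tendsto_zero.1 ?_
    rw [nhds_iInf]
    simp only [nhds_induced]
    exact tendsto_comap.mono_left (iInf_le _ r)

theorem isInverseLimitAlgAction_of_invariantSeminorms [ContinuousSub B] [T2Space B]
    (hgen : ∀ (l : Filter B) (b : B),
      (∀ r : InvariantSeminorm γ, Tendsto (fun x => r.1 (x - b)) l (𝓝 0)) → l ≤ 𝓝 b)
    (hcomplete : ∀ (l : Filter B) [l.NeBot], (∀ (r : InvariantSeminorm γ) (ε : ℝ), 0 < ε →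
      ∃ s ∈ l, ∀ x ∈ s, ∀ y ∈ s, r.1 (x - y) < ε) → ∃ b, l ≤ 𝓝 b) :
    IsInverseLimitAlgAction.{u, u} γ := by
  refine ⟨InvariantSeminorm γ, inferInstance, inferInstance, inferInstance, invariantSystem γ,
    fun r => CStarCompletion.hom r.1, completionAction γ,
    invariantSystem_isLimit γ hgen hcomplete, fun {l m} h g a => ?_,
    fun r g b => (completionHom_hom γ r g b).symm⟩
  refine DFunLike.congr_fun (CStarCompletion.hom_ext
    (φ := ((invariantSystem γ).map h).comp (completionHom γ l g))
    (ψ := (completionHom γ m g).comp ((invariantSystem γ).map h)) fun b => ?_) a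
  change (invariantSystem γ).map h (completionHom γ l g (CStarCompletion.hom l.1 b)) =
    completionHom γ m g ((invariantSystem γ).map h (CStarCompletion.hom l.1 b))
  rw [completionHom_hom, invariantSystem_map_hom, invariantSystem_map_hom, completionHom_hom]

end InvariantSeminorms

/-! ### Invariant seminorms of inverse limit actions -/

/-- Continuity of orbits, measured in an invariant seminorm, passes to limits. -/
theorem tendsto_orbit_of_approx {G B : Type*} [Group G] [TopologicalSpace G] [NonUnitalRing B]
    [StarRing B] [Module ℂ B] [TopologicalSpace B] {γ : G →* AlgAut B} {r : CStarSeminorm B}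
    (hr : ∀ (g : G) (b : B), r ((γ g).1 b) = r b) {b : B} {g₀ : G}
    (h : ∀ ε : ℝ, 0 < ε → ∃ b', r (b - b') < ε ∧
      Tendsto (fun g => r ((γ g).1 b' - (γ g₀).1 b')) (𝓝 g₀) (𝓝 0)) :
    Tendsto (fun g => r ((γ g).1 b - (γ g₀).1 b)) (𝓝 g₀) (𝓝 0) := by
  rw [Metric.tendsto_nhds]
  intro ε hε
  obtain ⟨b', hb', hlim⟩ := h (ε / 3) (by positivity)
  filter_upwards [hlim.eventually (gt_mem_nhds (show (0 : ℝ) < ε / 3 by positivity))] with g hg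
  rw [dist_zero_right, Real.norm_of_nonneg (r.nonneg _)]
  have e : (γ g).1 b - (γ g₀).1 b = (γ g).1 (b - b') + ((γ g).1 b' - (γ g₀).1 b')
      + (γ g₀).1 (b' - b) := by
    rw [map_sub, map_sub]; abel
  rw [e]
  have h1 := r.add_le ((γ g).1 (b - b') + ((γ g).1 b' - (γ g₀).1 b')) ((γ g₀).1 (b' - b))
  have h2 := r.add_le ((γ g).1 (b - b')) ((γ g).1 b' - (γ g₀).1 b')
  rw [hr] at h1 h2
  rw [r.sub_rev] at hb'
  rw [r.sub_rev b b'] at h2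
  linarith

section InverseLimit

/-- The C*-seminorm `a ↦ ‖π a‖` of a continuous `*`-homomorphism to a C*-algebra. -/
def normSeminorm {A C : Type*} [NonUnitalRing A] [StarRing A] [Module ℂ A] [TopologicalSpace A]
    [NonUnitalCStarAlgebra C] (π : A →⋆ₙₐ[ℂ] C) (hπ : Continuous π) : CStarSeminorm A where
  toFun a := ‖π a‖
  map_zero' := by rw [map_zero, norm_zero]
  add_le' a b := by rw [map_add]; exact norm_add_le _ _
  neg' a := by rw [map_neg, norm_neg]
  smul' c a := by rw [map_smul, norm_smul]
  mul_le' a b := by rw [map_mul]; exact norm_mul_le _ _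
  star_mul_self' a := by rw [map_mul, map_star, CStarRing.norm_star_mul_self, pow_two]
  continuous' := hπ.norm

open scoped CStarAlgebra in
/-- In an inverse limit of C*-algebras each continuous C*-seminorm is bounded by a multiple of one
of the seminorms `‖π_l ·‖`. -/
theorem CStarSystem.IsLimit.exists_le {Λ : Type w₁} [Preorder Λ] [IsDirectedOrder Λ] [Nonempty Λ]
    {S : CStarSystem.{w₁, w₂} Λ} {A : Type u} [NonUnitalRing A] [StarRing A] [Module ℂ A]
    [TopologicalSpace A] {π : ∀ l, A →⋆ₙₐ[ℂ] S.alg l} (h : S.IsLimit π) (p : CStarSeminorm A) :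
    ∃ l, ∃ C : ℝ, 0 ≤ C ∧ ∀ a, p a ≤ C * ‖π l a‖ := by
  have h0 : 𝓝 (0 : A) = ⨅ l, comap (π l) (𝓝 0) := by
    refine (congrArg (fun t => @nhds A t 0) h.topology_eq).trans ?_
    rw [nhds_iInf]
    simp only [nhds_induced, map_zero]
  have hdir : Directed (· ≥ ·) fun l => comap (π l) (𝓝 0) := by
    refine directed_of_isDirected_le fun m n hmn => ?_
    change comap _ _ ≤ comap _ _
    rw [← tendsto_iff_comap]
    have h1 : Continuous (S.map hmn) := map_continuous _
    have h2 := h1.tendsto 0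
    rw [map_zero] at h2
    exact (h2.comp tendsto_comap).congr fun x => h.coherent hmn x
  have h1 : {a | p a < 1} ∈ 𝓝 (0 : A) := by
    have := p.continuous.tendsto 0
    rw [p.zero] at this
    exact this.eventually (gt_mem_nhds zero_lt_one)
  rw [h0, mem_iInf_of_directed hdir] at h1
  obtain ⟨l, hl⟩ := h1
  obtain ⟨V, hV, hVl⟩ := mem_comap.1 hl
  obtain ⟨δ, hδ, hδV⟩ := Metric.mem_nhds_iff.1 hV
  refine ⟨l, δ⁻¹, inv_nonneg.2 hδ.le, fun a => ?_⟩
  have key : ∀ r, ‖π l a‖ < r → p a ≤ δ⁻¹ * r := by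
    intro r hr
    have hr0 : 0 < r := (norm_nonneg _).trans_lt hr
    have hn : ‖((δ / r : ℝ) : ℂ)‖ = δ / r := by
      rw [Complex.norm_real, Real.norm_of_nonneg (by positivity)]
    have h2 : ((δ / r : ℝ) : ℂ) • a ∈ {a | p a < 1} := by
      refine hVl (hδV ?_)
      rw [mem_ball_zero_iff, map_smul, norm_smul, hn, div_mul_eq_mul_div, div_lt_iff₀ hr0]
      exact mul_lt_mul_of_pos_left hr hδ
    have h3 : p (((δ / r : ℝ) : ℂ) • a) < 1 := h2
    rw [p.smul, hn, div_mul_eq_mul_div, div_lt_one hr0] at h3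
    rw [← div_eq_inv_mul, le_div_iff₀ hδ]
    linarith
  refine ge_of_tendsto (x := 𝓝[>] ‖π l a‖) (f := fun r => δ⁻¹ * r) ?_
    (eventually_nhdsWithin_of_forall key)
  exact tendsto_nhdsWithin_of_tendsto_nhds (tendsto_id.const_mul _)

variable {G : Type x} {A : Type u} {E : Type v} [Group G] [NonUnitalRing A] [StarRing A]
  [Module ℂ A] [TopologicalSpace A] [AddCommGroup E] [Module ℂ E] [InnerModule A E]

open scoped CStarAlgebra in
/-- For an inverse limit action on a full module, the seminorms of `A` which are invariant under the
induced action are cofinal. -/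
theorem IsInverseLimitAction.exists_invariant_seminorm (hfull : IsFull A E)
    {u : G →* HilbertAut A E} {α : G →* AlgAut A} (hα : IsInducedOnAlgebra u α)
    (hu : IsInverseLimitAction.{w₁, w₂, w₃} u) (p : CStarSeminorm A) :
    ∃ q : CStarSeminorm A, (∃ C : ℝ, 0 ≤ C ∧ ∀ a, p a ≤ C * q a) ∧
      ∀ (g : G) (a : A), q ((α g).1 a) = q a := by
  obtain ⟨Λ, _, _, _, S, π, σ, ul, hlim, -, hul⟩ := hu
  obtain ⟨l, C, hC, hp⟩ := hlim.alg_isLimit.exists_le p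
  have hπ : Continuous (π l) := by
    refine continuous_iff_le_induced.2 ?_
    exact hlim.alg_isLimit.topology_eq.le.trans (iInf_le _ l)
  have hle : ∀ (g : G) (a : A), ‖π l ((α g).1 a)‖ ≤ ‖π l a‖ := by
    intro g a
    obtain ⟨φ, hφ, hφu⟩ := (ul l g).2.1
    have h1 := hfull.hom_ext (φ := φ.comp (π l)) (ψ := (π l).comp (AlgAut.toHom (α g)))
      (hφ.comp hπ) (hπ.comp (α g).2.1) (fun ξ η => by
        change φ (π l (inner A ξ η)) = π l ((α g).1 (inner A ξ η))
        rw [hα, ← hlim.map_inner, ← hlim.map_inner, hul, hul]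
        exact (hφu _ _).symm) a
    have h2 : φ (π l a) = π l ((α g).1 a) := h1
    rw [← h2]
    exact NonUnitalStarAlgHom.norm_apply_le φ _
  refine ⟨normSeminorm (π l) hπ, ⟨C, hC, hp⟩, fun g a => le_antisymm (hle g a) ?_⟩
  have h3 := hle g⁻¹ ((α g).1 a)
  have h4 : (α g⁻¹).1 ((α g).1 a) = a := by
    rw [map_inv]; exact (α g).1.symm_apply_apply a
  rw [h4] at h3
  exact h3

end InverseLimit

/-! ### Continuity of the induced actions -/

section OrbitSubalgebra

variable {G : Type*} [Group G] [TopologicalSpace G] {B : Type*} [NonUnitalRing B] [StarRing B]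
  [Module ℂ B] [TopologicalSpace B] {γ : G →* AlgAut B} {r : CStarSeminorm B}

/-- The `*`-subalgebra of those `b` whose orbit `g ↦ γ_g b` is continuous at `g₀` with respect to
the invariant seminorm `r`. -/
def orbitSubalgebra (hr : ∀ (g : G) (b : B), r ((γ g).1 b) = r b) (g₀ : G) :
    NonUnitalStarSubalgebra ℂ B where
  carrier := {b | Tendsto (fun g => r ((γ g).1 b - (γ g₀).1 b)) (𝓝 g₀) (𝓝 0)}
  add_mem' {a b} ha hb := by
    have hab := Tendsto.add ha hb
    rw [add_zero] at hab
    refine squeeze_zero (fun g => r.nonneg _) (fun g => ?_) hab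
    rw [map_add, map_add, add_sub_add_comm]
    exact r.add_le _ _
  zero_mem' := by
    refine tendsto_const_nhds.congr fun g => ?_
    rw [map_zero, map_zero, sub_zero, r.zero]
  mul_mem' {a b} ha hb := by
    have hab := (Tendsto.const_mul (r a) hb).add (Tendsto.mul_const (r b) ha)
    rw [mul_zero, zero_mul, add_zero] at hab
    refine squeeze_zero (fun g => r.nonneg _) (fun g => ?_) hab
    have e : (γ g).1 (a * b) - (γ g₀).1 (a * b) =
        (γ g).1 a * ((γ g).1 b - (γ g₀).1 b) + ((γ g).1 a - (γ g₀).1 a) * (γ g₀).1 b := by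
      rw [map_mul, map_mul, mul_sub, sub_mul]; abel
    rw [e]
    have h1 := r.mul_le ((γ g).1 a) ((γ g).1 b - (γ g₀).1 b)
    have h2 := r.mul_le ((γ g).1 a - (γ g₀).1 a) ((γ g₀).1 b)
    rw [hr] at h1 h2
    exact (r.add_le _ _).trans (add_le_add h1 h2)
  smul_mem' c a ha := by
    have hca := Tendsto.const_mul ‖c‖ ha
    rw [mul_zero] at hca
    refine hca.congr fun g => ?_
    rw [map_smul, map_smul, ← smul_sub, r.smul]
  star_mem' {a} ha := by
    refine Tendsto.congr (fun g => ?_) ha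
    rw [map_star, map_star, ← star_sub, r.star]

theorem isClosed_orbitSubalgebra [IsScalarTower ℂ B B] [SMulCommClass ℂ B B] [StarModule ℂ B]
    [ContinuousSub B] (hr : ∀ (g : G) (b : B), r ((γ g).1 b) = r b)
    (g₀ : G) : IsClosed (orbitSubalgebra hr g₀ : Set B) := by
  refine isClosed_of_closure_subset fun b hb => ?_
  refine tendsto_orbit_of_approx hr fun ε hε => ?_
  have h1 : ∀ᶠ b' in 𝓝 b, r (b' - b) < ε := by
    have h2 := (r.continuous_sub b).tendsto b
    rw [sub_self, r.zero] at h2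
    exact h2.eventually (gt_mem_nhds hε)
  obtain ⟨b', hb', hb'S⟩ := mem_closure_iff_nhds.1 hb _ h1
  exact ⟨b', by rw [r.sub_rev]; exact hb', hb'S⟩

/-- Joint continuity is reduced to continuity of orbits. -/
theorem seminorm_apply_sub_apply_le (hr : ∀ (g : G) (b : B), r ((γ g).1 b) = r b) (g g₀ : G)
    (b b₀ : B) : r ((γ g).1 b - (γ g₀).1 b₀) ≤ r (b - b₀) + r ((γ g).1 b₀ - (γ g₀).1 b₀) := by
  rw [← hr g (b - b₀), map_sub, ← sub_add_sub_cancel ((γ g).1 b) ((γ g).1 b₀)]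
  exact r.add_le _ _

end OrbitSubalgebra

section CompactsAction

open AdjointableOp

section

variable {A F : Type*} [NonUnitalRing A] [StarRing A] [Module ℂ A]
  [IsScalarTower ℂ A A] [SMulCommClass ℂ A A] [StarModule ℂ A] [TopologicalSpace A]
  [AddCommGroup F] [Module ℂ F] [InnerModule A F]

instance : ContinuousSub (compacts A F) := by
  refine ⟨continuous_iff_continuousAt.2 fun z => compacts_tendsto_iff.2 fun p => ?_⟩
  have h1 := compacts_tendsto_iff.1 (continuous_fst.tendsto z) p
  have h2 := compacts_tendsto_iff.1 (continuous_snd.tendsto z) p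
  have h3 := h1.add h2
  rw [add_zero] at h3
  refine squeeze_zero (fun _ => CStarSeminorm.nonneg _ _) (fun y => ?_) h3
  rw [sub_sub_sub_comm]
  exact CStarSeminorm.sub_le _ _ _

end

variable {G A : Type*} {F : Type v} [Group G] [NonUnitalRing A] [StarRing A] [Module ℂ A]
  [IsScalarTower ℂ A A] [SMulCommClass ℂ A A] [StarModule ℂ A] [UniformSpace A]
  [IsLocallyCStarAlgebra A] [AddCommGroup F] [Module ℂ F] [UniformSpace F]
  [InnerModule A F] [HilbertModule A F] {w : G →* HilbertAut A F} {q : CStarSeminorm A}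

theorem compactsSeminorm_onCompacts
    (hq : ∀ (g : G) (x : F), moduleSeminorm q ((w g).1 x) = moduleSeminorm q x) (g : G)
    (T : compacts A F) :
    compactsSeminorm F q ((HilbertAut.onCompacts A F (w g)).1 T) = compactsSeminorm F q T := by
  have key : ∀ (g : G) (T : compacts A F),
      compactsSeminorm F q ((HilbertAut.onCompacts A F (w g)).1 T) ≤ compactsSeminorm F q T := by
    intro g T
    refine toReal_opSeminorm_le q (CStarSeminorm.nonneg _ _) fun x => ?_
    rw [HilbertAut.onCompacts_apply, HilbertAut.conjHom_op_apply, hq]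
    refine (moduleSeminorm_compacts_le q T _).trans_eq ?_
    rw [← map_inv, hq]
  refine le_antisymm (key g T) ?_
  have h := key g⁻¹ ((HilbertAut.onCompacts A F (w g)).1 T)
  have e : (HilbertAut.onCompacts A F (w g⁻¹)).1 ((HilbertAut.onCompacts A F (w g)).1 T) = T := by
    rw [map_inv, map_inv]
    exact (HilbertAut.onCompacts A F (w g)).1.symm_apply_apply T
  rwa [e] at h

variable [TopologicalSpace G]

theorem tendsto_orbit_onCompacts
    (hq : ∀ (g : G) (x : F), moduleSeminorm q ((w g).1 x) = moduleSeminorm q x)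
    (horb : ∀ x : F, Continuous fun g => (w g).1 x) (T : compacts A F) (g₀ : G) :
    Tendsto (fun g => compactsSeminorm F q ((HilbertAut.onCompacts A F (w g)).1 T -
      (HilbertAut.onCompacts A F (w g₀)).1 T)) (𝓝 g₀) (𝓝 0) := by
  refine closedStarAlgebraGenerated_induction (isClosed_orbitSubalgebra
    (γ := (HilbertAut.onCompacts A F).comp w) (compactsSeminorm_onCompacts hq) g₀) ?_ T
  rintro _ ⟨ξ, η, rfl⟩
  have hξ := (HilbertModule.tendsto_iff A).1 ((horb ξ).tendsto g₀) q
  have hη := (HilbertModule.tendsto_iff A).1 ((horb η).tendsto g₀) q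
  have h := (hξ.mul_const (moduleSeminorm q η)).add (hη.const_mul (moduleSeminorm q ξ))
  rw [zero_mul, mul_zero, add_zero] at h
  refine squeeze_zero (fun _ => CStarSeminorm.nonneg _ _) (fun g => ?_) h
  change compactsSeminorm F q ((HilbertAut.onCompacts A F (w g)).1 (theta ξ η) -
    (HilbertAut.onCompacts A F (w g₀)).1 (theta ξ η)) ≤ _
  rw [HilbertAut.onCompacts_theta, HilbertAut.onCompacts_theta]
  have e : theta (A := A) ((w g).1 ξ) ((w g).1 η) - theta ((w g₀).1 ξ) ((w g₀).1 η) =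
      theta ((w g).1 ξ - (w g₀).1 ξ) ((w g).1 η) +
        theta ((w g₀).1 ξ) ((w g).1 η - (w g₀).1 η) := by
    refine Subtype.ext (ext_op fun ζ => ?_)
    change (rankOne (A := A) ((w g).1 ξ) ((w g).1 η) -
      rankOne ((w g₀).1 ξ) ((w g₀).1 η)).op ζ = (rankOne (A := A) ((w g).1 ξ - (w g₀).1 ξ)
        ((w g).1 η) + rankOne ((w g₀).1 ξ) ((w g).1 η - (w g₀).1 η)).op ζ
    rw [sub_op, add_op, LinearMap.sub_apply, LinearMap.add_apply, rankOne_op_apply,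
      rankOne_op_apply, rankOne_op_apply, rankOne_op_apply, sub_rsmul, inner_sub_left, rsmul_sub]
    abel
  have hθ : ∀ x y : F, compactsSeminorm F q (theta x y) ≤ moduleSeminorm q x * moduleSeminorm q y :=
    fun x y => ENNReal.toReal_le_of_le_ofReal
      (mul_nonneg (moduleSeminorm_nonneg q x) (moduleSeminorm_nonneg q y))
      (opSeminorm_rankOne_le q x y)
  rw [e]
  refine (CStarSeminorm.add_le _ _ _).trans (add_le_add ((hθ _ _).trans_eq ?_)
    ((hθ _ _).trans_eq ?_))
  · rw [hq]
  · rw [hq]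

/-- If the seminorms of `A` which induce `w`-invariant seminorms on `F` are cofinal and `w` has
continuous orbits, then the action by conjugation on `K(F)` is jointly continuous. -/
theorem isContinuousAlgAction_onCompacts
    (hinv : ∀ p : CStarSeminorm A, ∃ q : CStarSeminorm A, (∃ C : ℝ, 0 ≤ C ∧ ∀ a, p a ≤ C * q a) ∧
      ∀ (g : G) (x : F), moduleSeminorm q ((w g).1 x) = moduleSeminorm q x)
    (horb : ∀ x : F, Continuous fun g => (w g).1 x) :
    IsContinuousAlgAction ((HilbertAut.onCompacts A F).comp w) := by
  refine continuous_iff_continuousAt.2 ?_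
  rintro ⟨g₀, T₀⟩
  refine compacts_tendsto_iff.2 fun p => ?_
  obtain ⟨q, ⟨C, hC, hpq⟩, hq⟩ := hinv p
  have h1 : Tendsto (fun z : G × compacts A F => compactsSeminorm F q
      ((HilbertAut.onCompacts A F (w z.1)).1 T₀ - (HilbertAut.onCompacts A F (w g₀)).1 T₀))
      (𝓝 (g₀, T₀)) (𝓝 0) :=
    (tendsto_orbit_onCompacts hq horb T₀ g₀).comp (continuous_fst.tendsto (g₀, T₀))
  have h2 : Tendsto (fun z : G × compacts A F => compactsSeminorm F q (z.2 - T₀))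
      (𝓝 (g₀, T₀)) (𝓝 0) :=
    compacts_tendsto_iff.1 (continuous_snd.tendsto (g₀, T₀)) q
  have h3 := h2.add h1
  rw [add_zero] at h3
  refine squeeze_zero (fun _ => CStarSeminorm.nonneg _ _) (fun z => ?_) h3
  refine (compactsSeminorm_le p q (Real.sqrt_nonneg C) (moduleSeminorm_le_of_le hC hpq) _).trans ?_
  exact seminorm_apply_sub_apply_le (γ := (HilbertAut.onCompacts A F).comp w)
    (compactsSeminorm_onCompacts hq) z.1 g₀ z.2 T₀

theorem isInverseLimitAlgAction_onCompacts
    (hinv : ∀ p : CStarSeminorm A, ∃ q : CStarSeminorm A, (∃ C : ℝ, 0 ≤ C ∧ ∀ a, p a ≤ C * q a) ∧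
      ∀ (g : G) (x : F), moduleSeminorm q ((w g).1 x) = moduleSeminorm q x) :
    IsInverseLimitAlgAction.{v, v} ((HilbertAut.onCompacts A F).comp w) := by
  have key : ∀ p : CStarSeminorm A,
      ∃ r : InvariantSeminorm ((HilbertAut.onCompacts A F).comp w),
        ∀ T, compactsSeminorm F p T ≤ r.1 T := by
    intro p
    obtain ⟨q, ⟨C, hC, hpq⟩, hq⟩ := hinv p
    exact ⟨⟨compactsSeminorm F q, compactsSeminorm_onCompacts hq⟩,
      compactsSeminorm_le p q (Real.sqrt_nonneg C) (moduleSeminorm_le_of_le hC hpq)⟩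
  refine isInverseLimitAlgAction_of_invariantSeminorms _ (fun l T h => ?_) fun l _ h => ?_
  · refine tendsto_id'.1 (compacts_tendsto_iff.2 fun p => ?_)
    obtain ⟨r, hr⟩ := key p
    exact squeeze_zero (fun _ => CStarSeminorm.nonneg _ _) (fun S => hr _) (h r)
  · obtain ⟨T, hT⟩ := compacts_exists_tendsto (f := id) (l := l) fun p ε hε => by
      obtain ⟨r, hr⟩ := key p
      obtain ⟨s, hs, hs'⟩ := h r ε hε
      exact ⟨s, hs, fun i hi j hj => (hr _).trans_lt (hs' i hi j hj)⟩
    exact ⟨T, tendsto_id'.1 hT⟩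

/-- The action by conjugation, transported along an equality `B = K(F)` of subalgebras of `L(F)`. -/
theorem exists_conj_action {B : NonUnitalStarSubalgebra ℂ (AdjointableOp A F)}
    (hB : B = compacts A F) (w : G →* HilbertAut A F) :
    ∃ γ : G →* AlgAut B, (∀ (g : G) (T : B), ((γ g).1 T).1 = HilbertAut.conjHom (w g) T.1) ∧
      ((∀ p : CStarSeminorm A, ∃ q : CStarSeminorm A, (∃ C : ℝ, 0 ≤ C ∧ ∀ a, p a ≤ C * q a) ∧
          ∀ (g : G) (x : F), moduleSeminorm q ((w g).1 x) = moduleSeminorm q x) →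
        (∀ x : F, Continuous fun g => (w g).1 x) →
        IsContinuousAlgAction γ ∧ IsInverseLimitAlgAction.{v, v} γ) := by
  subst hB
  exact ⟨(HilbertAut.onCompacts A F).comp w, fun g T => rfl, fun hinv horb =>
    ⟨isContinuousAlgAction_onCompacts hinv horb, isInverseLimitAlgAction_onCompacts hinv⟩⟩

end CompactsAction

section DirectSumContinuity

variable {G A E : Type*} [Group G] [NonUnitalRing A] [StarRing A] [Module ℂ A]
  [IsScalarTower ℂ A A] [SMulCommClass ℂ A A] [StarModule ℂ A] [UniformSpace A]
  [AddCommGroup E] [Module ℂ E] [UniformSpace E] [InnerModule A E]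
  {u : G →* HilbertAut A E} {α : G →* AlgAut A}

theorem moduleSeminorm_directSumAction (hα : IsInducedOnAlgebra u α) {q : CStarSeminorm A}
    (hq : ∀ (g : G) (a : A), q ((α g).1 a) = q a) (g : G) (x : A × E) :
    moduleSeminorm q ((directSumAction hα g).1 x) = moduleSeminorm q x := by
  rw [moduleSeminorm, moduleSeminorm, directSumAction_apply, directSum_inner, directSum_inner,
    ← hα, ← map_star, ← map_mul, ← map_add, hq]

variable [TopologicalSpace G] [IsLocallyCStarAlgebra A] [HilbertModule A E]

/-- If the invariant seminorms are cofinal, a continuous action on a full module induces an action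
on `A` with continuous orbits. -/
theorem continuous_orbit_of_isInducedOnAlgebra (hfull : IsFull A E) (hα : IsInducedOnAlgebra u α)
    (hinv : ∀ p : CStarSeminorm A, ∃ q : CStarSeminorm A, (∃ C : ℝ, 0 ≤ C ∧ ∀ a, p a ≤ C * q a) ∧
      ∀ (g : G) (a : A), q ((α g).1 a) = q a)
    (horb : ∀ ξ : E, Continuous fun g => (u g).1 ξ) (a : A) : Continuous fun g => (α g).1 a := by
  have := IsLocallyCStarAlgebra.isUniformAddGroup (A := A)
  refine continuous_iff_continuousAt.2 fun g₀ => ?_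
  have hspan : ∀ b ∈ Submodule.span ℂ {a : A | ∃ ξ η : E, a = inner A ξ η},
      Tendsto (fun g => (α g).1 b) (𝓝 g₀) (𝓝 ((α g₀).1 b)) := by
    intro b hb
    induction hb using Submodule.span_induction with
    | mem b hb =>
      obtain ⟨ξ, η, rfl⟩ := hb
      simp only [hα _ ξ η]
      exact HilbertModule.tendsto_inner ((horb ξ).tendsto g₀) ((horb η).tendsto g₀)
    | zero =>
      simp only [map_zero]
      exact tendsto_const_nhds
    | add b c _ _ hb hc =>
      simp only [map_add]
      exact hb.add hc
    | smul c b _ hb =>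
      refine IsLocallyCStarAlgebra.tendsto_iff.2 fun p => ?_
      have h := (IsLocallyCStarAlgebra.tendsto_iff.1 hb p).const_mul ‖c‖
      rw [mul_zero] at h
      refine h.congr fun g => ?_
      rw [map_smul, map_smul, ← smul_sub, p.smul]
  refine IsLocallyCStarAlgebra.tendsto_iff.2 fun p => ?_
  obtain ⟨q, ⟨C, hC, hpq⟩, hq⟩ := hinv p
  have h : Tendsto (fun g => q ((α g).1 a - (α g₀).1 a)) (𝓝 g₀) (𝓝 0) := by
    refine tendsto_orbit_of_approx hq fun ε hε => ?_
    have h1 : ∀ᶠ b in 𝓝 a, q (b - a) < ε := by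
      have h2 := (q.continuous_sub a).tendsto a
      rw [sub_self, q.zero] at h2
      exact h2.eventually (gt_mem_nhds hε)
    obtain ⟨b, hb, hbs⟩ := mem_closure_iff_nhds.1 (hfull a) _ h1
    exact ⟨b, by rw [q.sub_rev]; exact hb, IsLocallyCStarAlgebra.tendsto_iff.1 (hspan b hbs) q⟩
  have h' := h.const_mul C
  rw [mul_zero] at h'
  exact squeeze_zero (fun _ => p.nonneg _) (fun g => hpq _) h'

end DirectSumContinuity

end LCStar

end

theorem proposition3p1 {G : Type x} {A : Type u} {E : Type v}
    [Group G] [TopologicalSpace G] [IsTopologicalGroup G] [LocallyCompactSpace G]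
    [NonUnitalRing A] [StarRing A] [Module ℂ A] [IsScalarTower ℂ A A] [SMulCommClass ℂ A A]
    [StarModule ℂ A] [UniformSpace A] [IsLocallyCStarAlgebra A]
    [AddCommGroup E] [Module ℂ E] [UniformSpace E] [InnerModule A E] [HilbertModule A E]
    (hfull : IsFull A E) (u : G →* HilbertAut A E) :
    linkingAlgebra A E = compacts A (A × E) ∧
    (∃! α : G →* AlgAut A, IsInducedOnAlgebra u α) ∧
    (∃! β : G →* AlgAut (compacts A E), IsInducedOnCompacts u β) ∧
    ∀ (α : G →* AlgAut A) (β : G →* AlgAut (compacts A E)),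
      IsInducedOnAlgebra u α → IsInducedOnCompacts u β →
      ∃ γ : G →* AlgAut (linkingAlgebra A E),
        (∀ (g : G) (a : A) (ξ η : E) (T : compacts A E),
          (γ g).1 (linkingElt a ξ η T) =
            linkingElt ((α g).1 a) ((u g).1 ξ) ((u g).1 η) ((β g).1 T)) ∧
        (∀ γ' : G →* AlgAut (linkingAlgebra A E),
          (∀ (g : G) (a : A) (ξ η : E) (T : compacts A E),
            (γ' g).1 (linkingElt a ξ η T) =
              linkingElt ((α g).1 a) ((u g).1 ξ) ((u g).1 η) ((β g).1 T)) → γ' = γ) ∧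
        (IsContinuousAction u → IsInverseLimitAction.{w₁, w₂, w₃} u →
          IsContinuousAlgAction γ ∧ IsInverseLimitAlgAction.{max u v, max u v} γ) := by
  have := IsLocallyCStarAlgebra.t2 (A := A)
  refine ⟨linkingAlgebra_eq_compacts,
    ⟨(HilbertAut.onAlgebra hfull).comp u, fun g => HilbertAut.onAlgebra_inner hfull (u g),
      fun α hα => MonoidHom.ext fun g => hfull.algAut_ext fun ξ η => ?_⟩,
    ⟨(HilbertAut.onCompacts A E).comp u, fun g => HilbertAut.onCompacts_theta (u g),
      fun β hβ => MonoidHom.ext fun g => compacts_algAut_ext fun ξ η => ?_⟩,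
    fun α β hα hβ => ?_⟩
  · exact (hα g ξ η).trans (HilbertAut.onAlgebra_inner hfull (u g) ξ η).symm
  · exact (hβ g ξ η).trans (HilbertAut.onCompacts_theta (u g) ξ η).symm
  · have hL : linkingAlgebra A E = compacts A (A × E) := linkingAlgebra_eq_compacts
    have hex := exists_conj_action hL (directSumAction hα)
    obtain ⟨γ, hγ, hcont⟩ := hex
    have hβ' : ∀ g, β g = HilbertAut.onCompacts A E (u g) := fun g =>
      compacts_algAut_ext fun ξ η =>
        (hβ g ξ η).trans (HilbertAut.onCompacts_theta (u g) ξ η).symm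
    have hγL : ∀ (g : G) (a : A) (ξ η : E) (T : compacts A E), (γ g).1 (linkingElt a ξ η T) =
        linkingElt ((α g).1 a) ((u g).1 ξ) ((u g).1 η) ((β g).1 T) := by
      intro g a ξ η T
      refine Subtype.ext ((hγ g _).trans ?_)
      rw [hβ']
      exact conjHom_directSumAction_linkingOp hα g a ξ η T.1
    refine ⟨γ, hγL, fun γ' hγ' => MonoidHom.ext fun g => AlgAut.ext_of_generators ?_,
      fun hu hlim => ?_⟩
    · rintro _ ⟨a, ξ, η, T, rfl⟩
      exact (hγ' g a ξ η T).trans (hγL g a ξ η T).symm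
    · have hinv := hlim.exists_invariant_seminorm hfull hα
      have horb : ∀ ξ : E, Continuous fun g => (u g).1 ξ := fun ξ =>
        hu.comp (continuous_id.prodMk continuous_const)
      refine hcont (fun p => ?_) fun x =>
        (continuous_orbit_of_isInducedOnAlgebra hfull hα hinv horb x.1).prodMk (horb x.2)
      obtain ⟨q, hpq, hq⟩ := hinv p
      exact ⟨q, hpq, moduleSeminorm_directSumAction hα hq⟩
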